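/- Let $V$ be a finite set (e.g. the vertex set of a graph) with $m=\mathrm{card}(V)\ge 1$, let $\Pi$ be the uniform distribution on $V$, and let $\mathcal S_V$ be the space of symmetric kernels $S:V\times V\to\mathbb R$ (real symmetric $m\times m$ matrices). For a kernel $A$ put $\|A\|_{L_2(\Pi^2)}^2=m^{-2}\sum_{u,v\in V}|A(u,v)|^2$; for $S\in\mathcal S_V$ let $\|S\|_1$ be the nuclear norm (the sum of the absolute values of the eigenvalues) and let $\mathrm{supp}(S)\subset\mathbb R^V$ be the span of the eigenvectors of $S$ with nonzero eigenvalues. $P_L$ denotes the orthogonal projector onto a subspace $L\subset\mathbb R^V$, and $\{e_v\}_{v\in V}$ the canonical basis of $\mathbb R^V$. Let $S_*\in\mathcal S_V$ with $\mathrm{rank}(S_*)\ge1$, and let $(X_j,X_j',Y_j)$, $j=1,\dots,n$, be i.i.d. copies of a random triple $(X,X',Y)\in V\times V\times\{-1,1\}$, where $X,X'$ are independent with distribution $\Pi$ and $\mathbb E(Y\mid X=u,X'=v)=S_*(u,v)$ for all $u,v\in V$. Let $W=\sum_{k=1}^m\lambda_k(\phi_k\otimes\phi_k)$ be a symmetric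 nonnegative definite matrix, where $0\le\lambda_1\le\dots\le\lambda_m$ and $\phi_1,\dots,\phi_m$ are orthonormal, and suppose $W\ne0$. Let $k_0$ be the smallest $k$ with $\lambda_k>0$. Assume that for some $c>0$ and $\zeta\ge1$: $\lambda_m\le m^{\zeta}$ and $\lambda_{k_0}\ge m^{-\zeta}$; $s\mapsto s/\lambda_s$ is nonincreasing (with value $+\infty$ for $s<k_0$); $\lambda_{k+1}\le c\lambda_k$ for $k=k_0,\dots,m-1$; and $\sum_{k=s}^m\lambda_k^{-1}\le c\,s/\lambda_s$ for $s=k_0,\dots,m$. Put $\lambda_{m+1}^{-1}:=0$. Let $L=\mathrm{supp}(S_*)$ and define the coherence function $$\bar\varphi(S_*;k)=\max_{1\le t\le k}\ t\max_{t\le j\le m}\frac1j\sum_{i=1}^j\|P_L\phi_i\|^2,\quad k=1,\dots,m,\qquad \bar\varphi(S_*;m+1)=\bar\varphi(S_*;m).$$ Given $t>0$, let $t_{n,m}=t+\log\bigl(2m(\log_2(4n^{\zeta}m^{(3/2)\zeta})+2)\bigr)$, assume $m\,t_{n,m}\le n$, and set $\varepsilon=4\sqrt{\frac{t+\log(2m)}{nm}}$.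 Let $\mathbb D\subset\mathcal S_V$ be closed and convex with $S_*\in\mathbb D$ and, for $\bar\varepsilon\ge0$, let $$\hat S=\operatorname*{argmin}_{S\in\mathbb D}\Bigl[\|S\|_{L_2(\Pi^2)}^2-\frac2n\sum_{j=1}^nY_jS(X_j,X_j')+\varepsilon\|S\|_1+\bar\varepsilon\|W^{1/2}S\|_{L_2(\Pi^2)}^2\Bigr].$$ Then there exist constants $C,C_1>0$ depending only on $c$ such that, for all $s\in\{k_0+1,\dots,m+1\}$ and all $\bar\varepsilon\in[\lambda_s^{-1},\lambda_{s-1}^{-1}]$, with probability at least $1-e^{-t}$, $$\|\hat S-S_*\|_{L_2(\Pi^2)}^2\le C\,\frac{\bar\varphi(S_*;s)\,m\,t_{n,m}}{n}+\bar\varepsilon\,\|W^{1/2}S_*\|_{L_2(\Pi^2)}^2+C_1\max_{v\in V}\|P_Le_v\|^2\Bigl(\frac{m\,t_{n,m}}{n}\Bigr)^2 .$$ -/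

import Mathlib

open scoped BigOperators

/-- The linear space of symmetric kernels on `V × V` (real symmetric matrices). -/
abbrev SymKernel (V : Type*) [Fintype V] : Type _ := selfAdjoint (Matrix V V ℝ)

/-- The nuclear norm of a symmetric kernel: the sum of the absolute values of its eigenvalues
(with multiplicities). -/
noncomputable def nuclearNorm {V : Type*} [Fintype V] [DecidableEq V] (S : SymKernel V) : ℝ :=
  ∑ i, |Matrix.IsHermitian.eigenvalues (A := (S : Matrix V V ℝ)) S.2 i|

/-- The squared `L₂(Π²)`-norm of a kernel, `Π` being the uniform distribution on `V`. -/
noncomputable def l2NormSq {V : Type*} [Fintype V] (A : Matrix V V ℝ) : ℝ :=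
  (∑ u, ∑ v, |A u v| ^ 2) / (Fintype.card V : ℝ) ^ 2

open scoped MatrixOrder in
/-- The positive semidefinite square root of a (positive semidefinite) matrix. -/
noncomputable def sqrtMatrix {V : Type*} [Fintype V] [DecidableEq V] (W : Matrix V V ℝ) :
    Matrix V V ℝ :=
  CFC.sqrt W

/-- The support of a symmetric kernel: the linear span of its eigenvectors with nonzero
eigenvalues. -/
def kernelSupport {V : Type*} [Fintype V] [DecidableEq V] (S : SymKernel V) :
    Submodule ℝ (EuclideanSpace ℝ V) :=
  Submodule.span ℝ
    {ψ | ∃ σ : ℝ, σ ≠ 0 ∧ Matrix.toEuclideanLin (S : Matrix V V ℝ) ψ = σ • ψ}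

/-- `W = ∑_{k=1}^m lam k • (φ k ⊗ φ k)` with `0 ≤ lam 1 ≤ ⋯ ≤ lam m` and `φ 1, …, φ m`
orthonormal, `m` being the cardinality of `V`. Values at indices outside `1, …, m` play no role. -/
structure IsSpectralRepresentation {V : Type*} [Fintype V] (W : Matrix V V ℝ)
    (lam : ℕ → ℝ) (φ : ℕ → EuclideanSpace ℝ V) : Prop where
  orthonormal : Orthonormal ℝ (fun k : Finset.Icc 1 (Fintype.card V) => φ k)
  nonneg : ∀ k ∈ Finset.Icc 1 (Fintype.card V), 0 ≤ lam k
  mono : ∀ j ∈ Finset.Icc 1 (Fintype.card V), ∀ k ∈ Finset.Icc 1 (Fintype.card V),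
    j ≤ k → lam j ≤ lam k
  eq_sum : W = ∑ k ∈ Finset.Icc 1 (Fintype.card V), lam k • Matrix.vecMulVec (φ k) (φ k)

/-- The assumptions on the spectrum `lam 1 ≤ ⋯ ≤ lam m`: `k₀` is the index of the smallest positive
eigenvalue, `k / lam k` is nonincreasing (it is infinite for `k < k₀`), etc. -/
structure SpectrumRegular (m : ℕ) (lam : ℕ → ℝ) (k₀ : ℕ) (c ζ : ℝ) : Prop where
  isLeast : IsLeast {k | k ∈ Finset.Icc 1 m ∧ 0 < lam k} k₀
  upper : lam m ≤ (m : ℝ) ^ ζ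
  lower : (m : ℝ) ^ (-ζ) ≤ lam k₀
  antitone : ∀ j k : ℕ, k₀ ≤ j → j ≤ k → k ≤ m → (k : ℝ) / lam k ≤ (j : ℝ) / lam j
  ratio : ∀ k : ℕ, k₀ ≤ k → k + 1 ≤ m → lam (k + 1) ≤ c * lam k
  tail : ∀ s : ℕ, k₀ ≤ s → s ≤ m → ∑ k ∈ Finset.Icc s m, 1 / lam k ≤ c * (s / lam s)

/-- `(lam k)⁻¹` with the convention that it is `0` for `k > m`. -/
noncomputable def invEigenvalue (m : ℕ) (lam : ℕ → ℝ) (k : ℕ) : ℝ :=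
  if k ≤ m then (lam k)⁻¹ else 0

/-- The coherence function of a subspace `L` relative to `φ 1, …, φ m`:
`max_{1 ≤ t ≤ k} t * max_{t ≤ j ≤ m} (1 / j) ∑_{i=1}^j ‖P_L (φ i)‖²` for `1 ≤ k ≤ m`,
extended by its value at `m` for `k > m`, and equal to `0` for `k = 0`. -/
noncomputable def coherence {V : Type*} [Fintype V] (L : Submodule ℝ (EuclideanSpace ℝ V))
    (φ : ℕ → EuclideanSpace ℝ V) (k : ℕ) : ℝ :=
  sSup ((fun t : ℕ => (t : ℝ) *
      sSup ((fun j : ℕ => (1 / (j : ℝ)) * ∑ i ∈ Finset.Icc 1 j, ‖L.starProjection (φ i)‖ ^ 2) ''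
        Set.Icc t (Fintype.card V))) ''
    Set.Icc 1 (min k (Fintype.card V)))

/-- The largest squared norm `‖P_L e_v‖²` over the vectors `e_v` of the canonical basis. -/
noncomputable def maxLeverage {V : Type*} [Fintype V] [DecidableEq V]
    (L : Submodule ℝ (EuclideanSpace ℝ V)) : ℝ :=
  ⨆ v : V, ‖L.starProjection (EuclideanSpace.single v (1 : ℝ))‖ ^ 2

/-- `(X, X', Y)` is a random triple with `X, X'` independent and uniformly distributed in `V`,
`Y ∈ {-1, 1}` and `E(Y | X = u, X' = v) = S u v`. This determines the law of the triple. -/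
structure IsSimilarityTriple {V Ω : Type*} [Fintype V] [MeasurableSpace V] [MeasurableSpace Ω]
    (μ : MeasureTheory.Measure Ω) (S : SymKernel V) (X X' : Ω → V) (Y : Ω → ℝ) : Prop where
  measurable_left : Measurable X
  measurable_right : Measurable X'
  measurable_label : Measurable Y
  label : ∀ ω, Y ω = 1 ∨ Y ω = -1
  uniform_left : μ.map X = ProbabilityTheory.uniformOn (Set.univ : Set V)
  uniform_right : μ.map X' = ProbabilityTheory.uniformOn (Set.univ : Set V)
  indep : ProbabilityTheory.IndepFun X X' μ
  regression : ∀ u v : V,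
    ∫ ω, Y ω ∂(ProbabilityTheory.cond μ {ω | X ω = u ∧ X' ω = v}) = (S : Matrix V V ℝ) u v

/-- `(X j, X' j, Y j)`, `j = 1, …, n`, are independent copies of such a triple. -/
structure IsSimilaritySample {V Ω : Type*} [Fintype V] [MeasurableSpace V] [MeasurableSpace Ω]
    (μ : MeasureTheory.Measure Ω) (S : SymKernel V) {n : ℕ} (X X' : Fin n → Ω → V)
    (Y : Fin n → Ω → ℝ) : Prop where
  triple : ∀ j, IsSimilarityTriple μ S (X j) (X' j) (Y j)
  indep : ProbabilityTheory.iIndepFun (fun j ω => (X j ω, X' j ω, Y j ω)) μ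

/-- The penalized empirical risk
`‖S‖² - (2/n) ∑ⱼ yⱼ S(xⱼ, xⱼ') + ε ‖S‖₁ + ε' ‖W^{1/2} S‖²`, with `L₂(Π²)`-norms. -/
noncomputable def penalizedRisk {V : Type*} [Fintype V] [DecidableEq V] (W : Matrix V V ℝ)
    (ε ε' : ℝ) {n : ℕ} (x x' : Fin n → V) (y : Fin n → ℝ) (S : SymKernel V) : ℝ :=
  l2NormSq (S : Matrix V V ℝ)
    - 2 / (n : ℝ) * ∑ j, y j * (S : Matrix V V ℝ) (x j) (x' j)
    + ε * nuclearNorm S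
    + ε' * l2NormSq (sqrtMatrix W * (S : Matrix V V ℝ))

/-- `t_{n,m} = t + log (2m (log₂ (4 n^ζ m^{(3/2)ζ}) + 2))`. -/
noncomputable def tnm (t ζ : ℝ) (n m : ℕ) : ℝ :=
  t + Real.log (2 * m * (Real.logb 2 (4 * (n : ℝ) ^ ζ * (m : ℝ) ^ (3 / 2 * ζ)) + 2))

/-- The regularization parameter `ε = 4 √((t + log (2m)) / (n m))`. -/
noncomputable def nuclearPenalty (t : ℝ) (n m : ℕ) : ℝ :=
  4 * √((t + Real.log (2 * m)) / (n * m))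

/-!
Comparing `Ŝ` with the segment from `Ŝ` to `S_*` gives a variational inequality in which the noise
enters only through `Ξ = n⁻¹ ∑ⱼ Yⱼ (e_{Xⱼ} ⊗ e_{Xⱼ'})_sym - m⁻² S_*`. The subdifferential of the
nuclear norm at `S_*` contains `sign S_* + Q M Q` for every `‖Q M Q‖ ≤ 1`, with `P = P_L` and
`Q = 1 - P`; since `‖Q Ξ Q‖ ≤ ε / 2`, a suitable `M` absorbs the part of the noise off the support.
The remaining part is linear in `(Ŝ - S_*) P`. Young's inequality with the weight `1 + ε' W`, which
both quadratic terms supply, bounds it by the trace of `Ξ K Ξ` and by `ε² tr K`, where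
`K = P (1 + ε' W)⁻¹ P`. As `ε' ≥ λ_s⁻¹`, Abel summation and the tail condition on `λ` yield
`tr K = ∑ₖ ‖P φₖ‖² / (1 + ε' λₖ) ≤ (1 + c) φ̄(S_*; s)`.

Two deviation bounds control the noise: the matrix Bernstein inequality, by way of the
Golden–Thompson inequality, for `‖Ξ‖`, and a vector Bernstein inequality for the Frobenius norm of
`K^{1/2} Ξ`, whose variance is of order `tr K / (n m)`, and each summand has squared norm at most
of order `max_v ‖P e_v‖² / n²`.
-/

section LieProductFormula

open Filter Topology NormedSpace

variable {𝔸 : Type*} [NormedRing 𝔸]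

theorem norm_pow_sub_pow_le [NormOneClass 𝔸] {x y : 𝔸} {r : ℝ} (hr : 1 ≤ r) (hx : ‖x‖ ≤ r)
    (hy : ‖y‖ ≤ r) (N : ℕ) :
    ‖x ^ N - y ^ N‖ ≤ N * (r ^ N * ‖x - y‖) := by
  induction N with
  | zero => simp
  | succ N ih =>
    have htelescope : x ^ (N + 1) - y ^ (N + 1) = x ^ N * (x - y) + (x ^ N - y ^ N) * y := by
      rw [pow_succ x, pow_succ y]; noncomm_ring
    calc ‖x ^ (N + 1) - y ^ (N + 1)‖
        ≤ ‖x ^ N‖ * ‖x - y‖ + ‖x ^ N - y ^ N‖ * ‖y‖ := by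
          rw [htelescope]
          exact (norm_add_le _ _).trans (add_le_add (norm_mul_le _ _) (norm_mul_le _ _))
      _ ≤ r ^ N * ‖x - y‖ + N * (r ^ N * ‖x - y‖) * r := by
          gcongr
          exact (norm_pow_le _ _).trans (by gcongr)
      _ ≤ r ^ N * r * ‖x - y‖ + N * (r ^ N * ‖x - y‖) * r := by
          gcongr
          exact le_mul_of_one_le_right (by positivity) hr
      _ = (N + 1 : ℕ) * (r ^ (N + 1) * ‖x - y‖) := by push_cast; ring

variable [NormedAlgebra ℝ 𝔸] [CompleteSpace 𝔸]

theorem norm_exp_le_exp_norm [NormOneClass 𝔸] (x : 𝔸) : ‖exp x‖ ≤ Real.exp ‖x‖ := by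
  have hseries := exp_series_hasSum_exp' (𝕂 := ℝ) x
  have hseries_norm := exp_series_hasSum_exp' (𝕂 := ℝ) ‖x‖
  rw [← Real.exp_eq_exp_ℝ] at hseries_norm
  refine hseries.norm_le_of_bounded hseries_norm fun i => ?_
  rw [norm_smul, smul_eq_mul, Real.norm_of_nonneg (by positivity)]
  gcongr
  exact norm_pow_le x i

theorem tendsto_nat_mul_norm_exp_mul_exp_sub_exp_add (a b : 𝔸) :
    Tendsto (fun N : ℕ => (N : ℝ) *
      ‖exp ((N : ℝ)⁻¹ • a) * exp ((N : ℝ)⁻¹ • b) - exp ((N : ℝ)⁻¹ • (a + b))‖) atTop (𝓝 0) := by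
  let _ : NormedAlgebra ℚ 𝔸 := NormedAlgebra.restrictScalars ℚ ℝ 𝔸
  have hderiv : HasDerivAt
      (fun s : ℝ => exp (s • a) * exp (s • b) - exp (s • (a + b))) 0 0 := by
    have h := ((hasDerivAt_exp_smul_const (𝕂 := ℝ) a (0 : ℝ)).mul
      (hasDerivAt_exp_smul_const (𝕂 := ℝ) b (0 : ℝ))).sub
      (hasDerivAt_exp_smul_const (𝕂 := ℝ) (a + b) (0 : ℝ))
    exact h.congr_deriv (by simp)
  have hinv : Tendsto (fun N : ℕ => (N : ℝ)⁻¹) atTop (𝓝[≠] 0) :=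
    tendsto_nhdsWithin_iff.2 ⟨tendsto_inv_atTop_nhds_zero_nat,
      (eventually_ne_atTop 0).mono fun N hN => by simpa using hN⟩
  have hslope := ((hasDerivAt_iff_tendsto_slope_zero.1 hderiv).comp hinv).norm
  rw [norm_zero] at hslope
  refine hslope.congr fun N => ?_
  simp [norm_smul]

theorem norm_exp_mul_exp_pow_sub_exp_add_le [NormOneClass 𝔸] (a b : 𝔸) {N : ℕ} (hN : N ≠ 0) :
    ‖(exp ((N : ℝ)⁻¹ • a) * exp ((N : ℝ)⁻¹ • b)) ^ N - exp (a + b)‖ ≤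
      Real.exp (‖a‖ + ‖b‖) * (N *
        ‖exp ((N : ℝ)⁻¹ • a) * exp ((N : ℝ)⁻¹ • b) - exp ((N : ℝ)⁻¹ • (a + b))‖) := by
  let _ : NormedAlgebra ℚ 𝔸 := NormedAlgebra.restrictScalars ℚ ℝ 𝔸
  have hN' : (N : ℝ) ≠ 0 := Nat.cast_ne_zero.2 hN
  have norm_inv_smul (z : 𝔸) : ‖(N : ℝ)⁻¹ • z‖ = (N : ℝ)⁻¹ * ‖z‖ := by
    rw [norm_smul, Real.norm_of_nonneg (by positivity)]
  set r := Real.exp ((N : ℝ)⁻¹ * (‖a‖ + ‖b‖)) with hr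
  have hprod : ‖exp ((N : ℝ)⁻¹ • a) * exp ((N : ℝ)⁻¹ • b)‖ ≤ r := by
    rw [hr, mul_add, Real.exp_add, ← norm_inv_smul, ← norm_inv_smul]
    exact (norm_mul_le _ _).trans (by gcongr <;> exact norm_exp_le_exp_norm _)
  have hsum : ‖exp ((N : ℝ)⁻¹ • (a + b))‖ ≤ r := by
    refine (norm_exp_le_exp_norm _).trans (Real.exp_le_exp.2 ?_)
    rw [norm_inv_smul]
    gcongr
    exact norm_add_le _ _
  have hexp : exp (a + b) = exp ((N : ℝ)⁻¹ • (a + b)) ^ N := by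
    rw [← exp_nsmul, ← Nat.cast_smul_eq_nsmul ℝ, smul_inv_smul₀ hN']
  have hrN : r ^ N = Real.exp (‖a‖ + ‖b‖) := by
    rw [hr, ← Real.exp_nat_mul, mul_inv_cancel_left₀ hN']
  rw [hexp, ← hrN, mul_left_comm]
  exact norm_pow_sub_pow_le (Real.one_le_exp (by positivity)) hprod hsum N

theorem tendsto_exp_mul_exp_pow [NormOneClass 𝔸] (a b : 𝔸) :
    Tendsto (fun N : ℕ => (exp ((N : ℝ)⁻¹ • a) * exp ((N : ℝ)⁻¹ • b)) ^ N) atTop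
      (𝓝 (exp (a + b))) := by
  rw [tendsto_iff_norm_sub_tendsto_zero]
  refine squeeze_zero' (.of_forall fun _ => norm_nonneg _)
    ((eventually_ne_atTop 0).mono fun N hN => norm_exp_mul_exp_pow_sub_exp_add_le a b hN) ?_
  simpa using (tendsto_nat_mul_norm_exp_mul_exp_sub_exp_add a b).const_mul (Real.exp (‖a‖ + ‖b‖))

end LieProductFormula

section GoldenThompson

open Filter Topology Matrix
open scoped Matrix.Norms.L2Operator

variable {ι : Type*} [Fintype ι]

theorem trace_mul_le_add_div_two (A B : Matrix ι ι ℝ) :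
    (A * B).trace ≤ ((A * Aᴴ).trace + (B * Bᴴ).trace) / 2 := by
  have hsq : 0 ≤ ((A - Bᴴ) * (A - Bᴴ)ᴴ).trace := (posSemidef_self_mul_conjTranspose _).trace_nonneg
  have hadj : (Bᴴ * Aᴴ).trace = (A * B).trace := by
    rw [← conjTranspose_mul, trace_conjTranspose, star_trivial]
  simp only [conjTranspose_sub, conjTranspose_conjTranspose, sub_mul, mul_sub, trace_sub, hadj,
    trace_mul_comm Bᴴ B] at hsq
  linarith

variable [DecidableEq ι]

theorem trace_mul_pow_comm (A B : Matrix ι ι ℝ) (N : ℕ) :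
    ((A * B) ^ N).trace = ((B * A) ^ N).trace := by
  cases N with
  | zero => simp
  | succ N => rw [pow_succ, ← mul_assoc, mul_pow_mul, mul_assoc, trace_mul_comm, mul_assoc,
      ← pow_succ]

theorem trace_pow_two_pow_succ_le_of_trace_mul_pow_le {k : ℕ}
    (hmul : ∀ P Q : Matrix ι ι ℝ, P.IsHermitian → Q.IsHermitian →
      ((P * Q) ^ 2 ^ k).trace ≤ (P ^ 2 ^ k * Q ^ 2 ^ k).trace)
    (hself : ∀ M : Matrix ι ι ℝ, (M ^ 2 ^ (k + 1)).trace ≤ ((M * Mᴴ) ^ 2 ^ k).trace)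
    (M : Matrix ι ι ℝ) : (M ^ 2 ^ (k + 2)).trace ≤ ((M * Mᴴ) ^ 2 ^ (k + 1)).trace := by
  have hP : (Mᴴ * M).IsHermitian := isHermitian_conjTranspose_mul_self M
  have hQ : (M * Mᴴ).IsHermitian := isHermitian_mul_conjTranspose_self M
  calc (M ^ 2 ^ (k + 2)).trace = ((M ^ 2) ^ 2 ^ (k + 1)).trace := by rw [← pow_mul, ← pow_succ']
    _ ≤ ((M ^ 2 * (M ^ 2)ᴴ) ^ 2 ^ k).trace := hself _
    _ = ((M * (M * Mᴴ) * Mᴴ) ^ 2 ^ k).trace := by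
      rw [conjTranspose_pow]; simp only [sq, mul_assoc]
    _ = ((Mᴴ * M * (M * Mᴴ)) ^ 2 ^ k).trace := by rw [trace_mul_pow_comm, ← mul_assoc]
    _ ≤ ((Mᴴ * M) ^ 2 ^ k * (M * Mᴴ) ^ 2 ^ k).trace := hmul _ _ hP hQ
    _ ≤ (((Mᴴ * M) ^ 2 ^ (k + 1)).trace + ((M * Mᴴ) ^ 2 ^ (k + 1)).trace) / 2 := by
      refine (trace_mul_le_add_div_two _ _).trans_eq ?_
      rw [(hP.pow _).eq, (hQ.pow _).eq, ← pow_add, ← pow_add, ← two_mul, ← pow_succ']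
    _ = ((M * Mᴴ) ^ 2 ^ (k + 1)).trace := by rw [trace_mul_pow_comm Mᴴ M, add_self_div_two]

theorem trace_mul_pow_two_pow_succ_le {k : ℕ}
    (hmul : ∀ P Q : Matrix ι ι ℝ, P.IsHermitian → Q.IsHermitian →
      ((P * Q) ^ 2 ^ k).trace ≤ (P ^ 2 ^ k * Q ^ 2 ^ k).trace)
    (hself : ∀ M : Matrix ι ι ℝ, (M ^ 2 ^ (k + 1)).trace ≤ ((M * Mᴴ) ^ 2 ^ k).trace)
    {P Q : Matrix ι ι ℝ} (hP : P.IsHermitian) (hQ : Q.IsHermitian) :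
    ((P * Q) ^ 2 ^ (k + 1)).trace ≤ (P ^ 2 ^ (k + 1) * Q ^ 2 ^ (k + 1)).trace :=
  calc ((P * Q) ^ 2 ^ (k + 1)).trace ≤ ((P * Q * (P * Q)ᴴ) ^ 2 ^ k).trace := hself _
    _ = ((P * (Q * Q * P)) ^ 2 ^ k).trace := by
      rw [conjTranspose_mul, hP.eq, hQ.eq]; simp only [mul_assoc]
    _ = ((P ^ 2 * Q ^ 2) ^ 2 ^ k).trace := by
      rw [trace_mul_pow_comm, mul_assoc, trace_mul_pow_comm, sq, sq]
    _ ≤ ((P ^ 2) ^ 2 ^ k * (Q ^ 2) ^ 2 ^ k).trace := hmul _ _ (hP.pow 2) (hQ.pow 2)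
    _ = (P ^ 2 ^ (k + 1) * Q ^ 2 ^ (k + 1)).trace := by
      rw [← pow_mul, ← pow_mul, ← pow_succ']

theorem trace_mul_pow_two_pow_le {P Q : Matrix ι ι ℝ} (hP : P.IsHermitian) (hQ : Q.IsHermitian)
    (k : ℕ) : ((P * Q) ^ 2 ^ k).trace ≤ (P ^ 2 ^ k * Q ^ 2 ^ k).trace := by
  suffices (∀ P Q : Matrix ι ι ℝ, P.IsHermitian → Q.IsHermitian →
      ((P * Q) ^ 2 ^ k).trace ≤ (P ^ 2 ^ k * Q ^ 2 ^ k).trace) ∧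
      ∀ M : Matrix ι ι ℝ, (M ^ 2 ^ (k + 1)).trace ≤ ((M * Mᴴ) ^ 2 ^ k).trace from
    this.1 P Q hP hQ
  induction k with
  | zero => exact ⟨by simp, fun M => by simpa [sq] using trace_mul_le_add_div_two M M⟩
  | succ k ih =>
    exact ⟨fun _ _ => trace_mul_pow_two_pow_succ_le ih.1 ih.2,
      trace_pow_two_pow_succ_le_of_trace_mul_pow_le ih.1 ih.2⟩

/-- The **Golden–Thompson inequality** for real symmetric matrices. -/
theorem trace_exp_add_le {A B : Matrix ι ι ℝ} (hA : A.IsHermitian) (hB : B.IsHermitian) :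
    (NormedSpace.exp (A + B)).trace ≤ (NormedSpace.exp A * NormedSpace.exp B).trace := by
  cases isEmpty_or_nonempty ι
  · simp [trace]
  have hlim : Tendsto (fun k : ℕ => ((NormedSpace.exp (((2 ^ k : ℕ) : ℝ)⁻¹ • A) *
      NormedSpace.exp (((2 ^ k : ℕ) : ℝ)⁻¹ • B)) ^ 2 ^ k).trace) atTop
      (𝓝 (NormedSpace.exp (A + B)).trace) :=
    ((continuous_id.matrix_trace.tendsto _).comp (tendsto_exp_mul_exp_pow A B)).comp
      (tendsto_pow_atTop_atTop_of_one_lt one_lt_two)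
  refine le_of_tendsto' hlim fun k => ?_
  have exp_smul_pow (C : Matrix ι ι ℝ) :
      NormedSpace.exp (((2 ^ k : ℕ) : ℝ)⁻¹ • C) ^ 2 ^ k = NormedSpace.exp C := by
    rw [← Matrix.exp_nsmul, ← Nat.cast_smul_eq_nsmul ℝ, smul_inv_smul₀ (by positivity)]
  have isHermitian_exp_smul {C : Matrix ι ι ℝ} (hC : C.IsHermitian) :
      (NormedSpace.exp (((2 ^ k : ℕ) : ℝ)⁻¹ • C)).IsHermitian :=
    (hC.smul (IsSelfAdjoint.all _)).exp
  refine (trace_mul_pow_two_pow_le (isHermitian_exp_smul hA) (isHermitian_exp_smul hB) k).trans_eq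
    ?_
  rw [exp_smul_pow, exp_smul_pow]

end GoldenThompson

section LoewnerOrder

open Matrix
open scoped MatrixOrder Matrix.Norms.L2Operator

variable {ι : Type*}

instance [Finite ι] : OrderClosedTopology (Matrix ι ι ℝ) where
  isClosed_le' := by
    have := Fintype.ofFinite ι
    have hquad (x : ι → ℝ) : IsClosed
        {p : Matrix ι ι ℝ × Matrix ι ι ℝ | 0 ≤ x ⬝ᵥ (p.2 - p.1) *ᵥ x} :=
      isClosed_le continuous_const (by fun_prop)
    have hherm : IsClosed {p : Matrix ι ι ℝ × Matrix ι ι ℝ | (p.2 - p.1)ᴴ = p.2 - p.1} :=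
      isClosed_eq (by fun_prop) (by fun_prop)
    convert hherm.inter (isClosed_iInter hquad) using 1
    ext p
    simp [Matrix.le_iff, posSemidef_iff_dotProduct_mulVec, IsHermitian]

variable [Fintype ι]

theorem trace_mul_nonneg {A B : Matrix ι ι ℝ} (hA : 0 ≤ A) (hB : 0 ≤ B) : 0 ≤ (A * B).trace := by
  classical
  obtain ⟨R, rfl⟩ := CStarAlgebra.nonneg_iff_eq_star_mul_self.1 hA
  rw [mul_assoc, trace_mul_comm, star_eq_conjTranspose]
  exact ((nonneg_iff_posSemidef.1 hB).mul_mul_conjTranspose_same R).trace_nonneg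

theorem trace_mul_le_trace_mul_right {P A B : Matrix ι ι ℝ} (hP : 0 ≤ P) (hAB : A ≤ B) :
    (P * A).trace ≤ (P * B).trace := by
  have := trace_mul_nonneg hP (sub_nonneg.2 hAB)
  rwa [mul_sub, trace_sub, sub_nonneg] at this

variable [DecidableEq ι]

theorem trace_cfc {A : Matrix ι ι ℝ} (hA : A.IsHermitian) (f : ℝ → ℝ) :
    (cfc f A).trace = ∑ i, f (hA.eigenvalues i) := by
  rw [hA.cfc_eq, IsHermitian.cfc, Unitary.conjStarAlgAut_apply, trace_mul_cycle,
    Unitary.coe_star_mul_self, one_mul, trace_diagonal]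
  rfl

theorem exp_le_trace_exp {A : Matrix ι ι ℝ} (hA : A.IsHermitian) {x : ℝ} (hx : x ∈ spectrum ℝ A) :
    Real.exp x ≤ (NormedSpace.exp A).trace := by
  obtain ⟨i, rfl⟩ := hA.spectrum_real_eq_range_eigenvalues.le hx
  rw [← CFC.real_exp_eq_normedSpace_exp hA.isSelfAdjoint, trace_cfc hA]
  exact Finset.single_le_sum (f := fun i => Real.exp (hA.eigenvalues i))
    (fun _ _ => (Real.exp_pos _).le) (Finset.mem_univ i)

theorem trace_exp_nonneg {A : Matrix ι ι ℝ} (hA : A.IsHermitian) :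
    0 ≤ (NormedSpace.exp A).trace :=
  (nonneg_iff_posSemidef.1 hA.isSelfAdjoint.exp_nonneg).trace_nonneg

theorem exp_norm_le_trace_exp_add [Nonempty ι] {A : Matrix ι ι ℝ} (hA : A.IsHermitian) :
    Real.exp ‖A‖ ≤ (NormedSpace.exp A).trace + (NormedSpace.exp (-A)).trace := by
  obtain ⟨x, hx, hxA : ‖x‖ = ‖A‖⟩ :=
    (IsometricContinuousFunctionalCalculus.isGreatest_norm_spectrum (𝕜 := ℝ) A hA.isSelfAdjoint).1
  rw [← hxA, Real.norm_eq_abs]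
  rcases abs_choice x with habs | habs
  · rw [habs]
    exact (exp_le_trace_exp hA hx).trans (le_add_of_nonneg_right (trace_exp_nonneg hA.neg))
  · rw [habs]
    exact (exp_le_trace_exp hA.neg (by rwa [← spectrum.neg_eq, Set.neg_mem_neg])).trans
      (le_add_of_nonneg_left (trace_exp_nonneg hA))

theorem exp_le_one_add_self_add_sq {A : Matrix ι ι ℝ} (hA : A.IsHermitian) (hnorm : ‖A‖ ≤ 1) :
    NormedSpace.exp A ≤ 1 + A + (3 / 4 : ℝ) • A ^ 2 := by
  have hpoly : cfc (fun x : ℝ => 1 + x + (3 / 4 : ℝ) • x ^ 2) A = 1 + A + (3 / 4 : ℝ) • A ^ 2 := by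
    have := hA.isSelfAdjoint
    rw [cfc_add .., cfc_add .., cfc_const_one .., cfc_id' .., cfc_smul .., cfc_pow_id ..]
  rw [← CFC.real_exp_eq_normedSpace_exp hA.isSelfAdjoint, ← hpoly]
  refine cfc_mono fun x hx => ?_
  have hx1 : |x| ≤ 1 :=
    (IsometricContinuousFunctionalCalculus.norm_spectrum_le A hx hA.isSelfAdjoint).trans hnorm
  have hexp := (abs_le.1 (Real.exp_bound hx1 (n := 2) (by norm_num))).2
  rw [Finset.sum_range_succ, Finset.sum_range_one, sq_abs] at hexp
  norm_num at hexp ⊢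
  linarith

end LoewnerOrder

section MatrixBernstein

open Matrix MeasureTheory ProbabilityTheory
open scoped MatrixOrder Matrix.Norms.L2Operator

instance {m n : Type*} : MeasurableSpace (Matrix m n ℝ) := borel _

instance {m n : Type*} : BorelSpace (Matrix m n ℝ) := ⟨rfl⟩

instance {m n : Type*} [Countable m] [Countable n] :
    SecondCountableTopology (Matrix m n ℝ) :=
  inferInstanceAs (SecondCountableTopology (m → n → ℝ))

variable {Ω ι : Type*} [MeasurableSpace Ω] {μ : Measure Ω} [IsProbabilityMeasure μ]
  [Fintype ι] [DecidableEq ι]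

theorem integrable_continuous_comp {E F : Type*} [NormedAddCommGroup E] [ProperSpace E]
    [MeasurableSpace E] [BorelSpace E] [NormedAddCommGroup F] [SecondCountableTopology F]
    {Z : Ω → E} (hZ : Measurable Z) {r : ℝ} (hnorm : ∀ ω, ‖Z ω‖ ≤ r) {f : E → F}
    (hf : Continuous f) : Integrable (fun ω => f (Z ω)) μ := by
  borelize F
  obtain ⟨b, hb⟩ := (isCompact_closedBall (0 : E) r).exists_bound_of_continuousOn hf.continuousOn
  exact .of_bound (hf.measurable.comp hZ).aestronglyMeasurable b
    (.of_forall fun ω => hb _ (mem_closedBall_zero_iff.2 (hnorm ω)))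

@[fun_prop]
theorem continuous_matrix_exp : Continuous (NormedSpace.exp : Matrix ι ι ℝ → Matrix ι ι ℝ) := by
  let _ : NormedAlgebra ℚ (Matrix ι ι ℝ) := .restrictScalars ℚ ℝ _
  exact NormedSpace.exp_continuous

theorem integral_exp_le {Z : Ω → Matrix ι ι ℝ} (hZ : Measurable Z)
    (hherm : ∀ ω, (Z ω).IsHermitian) (hnorm : ∀ ω, ‖Z ω‖ ≤ 1) (hmean : ∫ ω, Z ω ∂μ = 0)
    {v : ℝ} (hsq : ∫ ω, Z ω ^ 2 ∂μ ≤ v • 1) :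
    ∫ ω, NormedSpace.exp (Z ω) ∂μ ≤ Real.exp (3 / 4 * v) • (1 : Matrix ι ι ℝ) := by
  have hint {f : Matrix ι ι ℝ → Matrix ι ι ℝ} (hf : Continuous f) :
      Integrable (fun ω => f (Z ω)) μ := integrable_continuous_comp hZ hnorm hf
  calc
    ∫ ω, NormedSpace.exp (Z ω) ∂μ
        ≤ ∫ ω, (1 + Z ω + (3 / 4 : ℝ) • Z ω ^ 2) ∂μ :=
      integral_mono (hint continuous_matrix_exp)
        (hint (f := fun A => 1 + A + (3 / 4 : ℝ) • A ^ 2) (by fun_prop))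
        fun ω => exp_le_one_add_self_add_sq (hherm ω) (hnorm ω)
    _ = 1 + (3 / 4 : ℝ) • ∫ ω, Z ω ^ 2 ∂μ := by
      rw [integral_add (hint (f := fun A => 1 + A) (by fun_prop))
          (hint (f := fun A => (3 / 4 : ℝ) • A ^ 2) (by fun_prop)),
        integral_add (integrable_const _) (hint continuous_id'), integral_smul, hmean,
        integral_const, probReal_univ, one_smul, add_zero]
    _ ≤ 1 + (3 / 4 : ℝ) • v • (1 : Matrix ι ι ℝ) := by gcongr
    _ = (1 + 3 / 4 * v) • (1 : Matrix ι ι ℝ) := by rw [add_smul, one_smul, mul_smul]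
    _ ≤ Real.exp (3 / 4 * v) • (1 : Matrix ι ι ℝ) := by
      gcongr
      linarith [Real.add_one_le_exp (3 / 4 * v)]

theorem integral_trace_exp_add_le {S Z : Ω → Matrix ι ι ℝ} (hindep : S ⟂ᵢ[μ] Z)
    (hS : Measurable S) (hSherm : ∀ ω, (S ω).IsHermitian) {r : ℝ} (hSnorm : ∀ ω, ‖S ω‖ ≤ r)
    (hZ : Measurable Z) (hZherm : ∀ ω, (Z ω).IsHermitian) (hZnorm : ∀ ω, ‖Z ω‖ ≤ 1)
    (hmean : ∫ ω, Z ω ∂μ = 0) {v : ℝ} (hsq : ∫ ω, Z ω ^ 2 ∂μ ≤ v • 1) :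
    ∫ ω, (NormedSpace.exp (S ω + Z ω)).trace ∂μ ≤
      Real.exp (3 / 4 * v) * ∫ ω, (NormedSpace.exp (S ω)).trace ∂μ := by
  let tr : Matrix ι ι ℝ →L[ℝ] ℝ := (traceLinearMap ι ℝ ℝ).toContinuousLinearMap
  have hexpS : Integrable (fun ω => NormedSpace.exp (S ω)) μ :=
    integrable_continuous_comp hS hSnorm continuous_matrix_exp
  have hexpZ : Integrable (fun ω => NormedSpace.exp (Z ω)) μ :=
    integrable_continuous_comp hZ hZnorm continuous_matrix_exp
  have hSZnorm (ω) : ‖S ω + Z ω‖ ≤ r + 1 :=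
    (norm_add_le _ _).trans (add_le_add (hSnorm ω) (hZnorm ω))
  have hprodnorm (ω) : ‖(S ω, Z ω)‖ ≤ max r 1 := max_le_max (hSnorm ω) (hZnorm ω)
  have hexp_indep : (fun ω => NormedSpace.exp (S ω)) ⟂ᵢ[μ] fun ω => NormedSpace.exp (Z ω) :=
    hindep.comp continuous_matrix_exp.measurable continuous_matrix_exp.measurable
  calc
    ∫ ω, (NormedSpace.exp (S ω + Z ω)).trace ∂μ
        ≤ ∫ ω, (NormedSpace.exp (S ω) * NormedSpace.exp (Z ω)).trace ∂μ :=
      integral_mono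
        (integrable_continuous_comp (hS.add hZ) hSZnorm
          (f := fun A => (NormedSpace.exp A).trace) (by fun_prop))
        (integrable_continuous_comp (hS.prodMk hZ) hprodnorm
          (f := fun p => (NormedSpace.exp p.1 * NormedSpace.exp p.2).trace) (by fun_prop))
        fun ω => trace_exp_add_le (hSherm ω) (hZherm ω)
    _ = ((∫ ω, NormedSpace.exp (S ω) ∂μ) * ∫ ω, NormedSpace.exp (Z ω) ∂μ).trace :=
      hexp_indep.integral_bilin hexpS hexpZ
        ((ContinuousLinearMap.compL ℝ _ _ _ tr).comp (ContinuousLinearMap.mul ℝ _))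
    _ ≤ ((∫ ω, NormedSpace.exp (S ω) ∂μ) * (Real.exp (3 / 4 * v) • 1)).trace :=
      trace_mul_le_trace_mul_right
        (integral_nonneg fun ω => (hSherm ω).isSelfAdjoint.exp_nonneg)
        (integral_exp_le hZ hZherm hZnorm hmean hsq)
    _ = Real.exp (3 / 4 * v) * ∫ ω, (NormedSpace.exp (S ω)).trace ∂μ := by
      rw [mul_smul_comm, mul_one, trace_smul, smul_eq_mul]
      exact congrArg _ (tr.integral_comp_comm hexpS).symm

theorem integral_trace_exp_sum_le {κ : Type*} {Z : κ → Ω → Matrix ι ι ℝ} (hindep : iIndepFun Z μ)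
    (hZ : ∀ j, Measurable (Z j)) (hherm : ∀ j ω, (Z j ω).IsHermitian)
    (hnorm : ∀ j ω, ‖Z j ω‖ ≤ 1) (hmean : ∀ j, ∫ ω, Z j ω ∂μ = 0) {v : κ → ℝ}
    (hsq : ∀ j, ∫ ω, Z j ω ^ 2 ∂μ ≤ v j • 1) (s : Finset κ) :
    ∫ ω, (NormedSpace.exp (∑ j ∈ s, Z j ω)).trace ∂μ ≤
      Fintype.card ι * Real.exp (3 / 4 * ∑ j ∈ s, v j) := by
  classical
  induction s using Finset.induction_on with
  | empty => simp
  | insert j s hj ih =>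
    have hsum_indep : (fun ω => ∑ i ∈ s, Z i ω) ⟂ᵢ[μ] Z j := by
      simpa only [Finset.sum_fn] using hindep.indepFun_finsetSum_of_notMem hZ hj
    have hstep := integral_trace_exp_add_le hsum_indep (s.measurable_fun_sum fun i _ => hZ i)
      (fun ω => isSelfAdjoint_sum s fun i _ => hherm i ω)
      (fun ω => norm_sum_le_of_le s fun i _ => hnorm i ω)
      (hZ j) (hherm j) (hnorm j) (hmean j) (hsq j)
    simp only [Finset.sum_insert hj, add_comm (Z j _)]
    calc
      _ ≤ _ := hstep
      _ ≤ Real.exp (3 / 4 * v j) * (Fintype.card ι * Real.exp (3 / 4 * ∑ i ∈ s, v i)) := by gcongr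
      _ = _ := by rw [mul_add, Real.exp_add]; ring

theorem exp_mul_measureReal_le_norm_le [Nonempty ι] {S : Ω → Matrix ι ι ℝ} (hS : Measurable S)
    (hherm : ∀ ω, (S ω).IsHermitian) {r : ℝ} (hnorm : ∀ ω, ‖S ω‖ ≤ r) {θ : ℝ} (hθ : 0 ≤ θ)
    (x : ℝ) :
    Real.exp (θ * x) * μ.real {ω | x ≤ ‖S ω‖} ≤
      ∫ ω, (NormedSpace.exp (θ • S ω)).trace ∂μ + ∫ ω, (NormedSpace.exp (-θ • S ω)).trace ∂μ := by
  have hint (a : ℝ) : Integrable (fun ω => (NormedSpace.exp (a • S ω)).trace) μ :=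
    integrable_continuous_comp hS hnorm (f := fun A => (NormedSpace.exp (a • A)).trace)
      (by fun_prop)
  have hpos (a : ℝ) (ω) : 0 ≤ (NormedSpace.exp (a • S ω)).trace :=
    trace_exp_nonneg ((hherm ω).smul (IsSelfAdjoint.all a))
  have hle (ω) : Real.exp (θ * ‖S ω‖) ≤
      (NormedSpace.exp (θ • S ω)).trace + (NormedSpace.exp (-θ • S ω)).trace := by
    have := exp_norm_le_trace_exp_add ((hherm ω).smul (IsSelfAdjoint.all θ))
    rwa [norm_smul, Real.norm_of_nonneg hθ, ← neg_smul] at this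
  rw [← integral_add (hint θ) (hint (-θ))]
  refine le_trans ?_ (mul_meas_ge_le_integral_of_nonneg
    (.of_forall fun ω => add_nonneg (hpos θ ω) (hpos (-θ) ω)) ((hint θ).add (hint (-θ)))
    (Real.exp (θ * x)))
  refine mul_le_mul_of_nonneg_left (measureReal_mono fun ω hx => ?_) (Real.exp_nonneg _)
  exact (Real.exp_le_exp.2 (mul_le_mul_of_nonneg_left hx hθ)).trans (hle ω)

/-- The matrix Bernstein inequality, before the choice of the Laplace parameter `θ`. -/
theorem measureReal_le_norm_sum_le [Nonempty ι] {κ : Type*} {Z : κ → Ω → Matrix ι ι ℝ}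
    (hindep : iIndepFun Z μ) (hZ : ∀ j, Measurable (Z j)) (hherm : ∀ j ω, (Z j ω).IsHermitian)
    {U : ℝ} (hnorm : ∀ j ω, ‖Z j ω‖ ≤ U) (hmean : ∀ j, ∫ ω, Z j ω ∂μ = 0) {v : κ → ℝ}
    (hsq : ∀ j, ∫ ω, Z j ω ^ 2 ∂μ ≤ v j • 1) (s : Finset κ) {θ : ℝ} (hθ : 0 ≤ θ)
    (hθU : θ * U ≤ 1) (x : ℝ) :
    μ.real {ω | x ≤ ‖∑ j ∈ s, Z j ω‖} ≤
      2 * Fintype.card ι * Real.exp (3 / 4 * θ ^ 2 * ∑ j ∈ s, v j - θ * x) := by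
  have hlaplace (a : ℝ) (ha : |a| = θ) :
      ∫ ω, (NormedSpace.exp (a • ∑ j ∈ s, Z j ω)).trace ∂μ ≤
        Fintype.card ι * Real.exp (3 / 4 * θ ^ 2 * ∑ j ∈ s, v j) := by
    have hsq' (j) : ∫ ω, (a • Z j ω) ^ 2 ∂μ ≤ (a ^ 2 * v j) • (1 : Matrix ι ι ℝ) := by
      simp only [smul_pow, integral_smul, mul_smul]
      exact smul_le_smul_of_nonneg_left (hsq j) (sq_nonneg a)
    have := integral_trace_exp_sum_le (hindep.comp (fun _ A => a • A) fun _ => by fun_prop)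
      (fun j => (hZ j).const_smul a) (fun j ω => (hherm j ω).smul (IsSelfAdjoint.all a))
      (fun j ω => (norm_smul_le a _).trans
        ((mul_le_mul_of_nonneg_left (hnorm j ω) (abs_nonneg a)).trans (ha ▸ hθU)))
      (fun j => by simp only [Function.comp, integral_smul, hmean j, smul_zero]) hsq' s
    simpa only [Function.comp, ← Finset.smul_sum, ← Finset.mul_sum, ← mul_assoc, ← sq_abs a, ha]
      using this
  have hmarkov := exp_mul_measureReal_le_norm_le (μ := μ) (s.measurable_fun_sum fun j _ => hZ j)
    (fun ω => isSelfAdjoint_sum s fun j _ => hherm j ω)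
    (fun ω => norm_sum_le_of_le s fun j _ => hnorm j ω) hθ x
  rw [Real.exp_sub, ← mul_div_assoc, le_div_iff₀' (Real.exp_pos _)]
  linarith [hlaplace θ (abs_of_nonneg hθ), hlaplace (-θ) (by rw [abs_neg, abs_of_nonneg hθ])]

end MatrixBernstein

section VectorDilation

open Matrix
open scoped MatrixOrder Matrix.Norms.L2Operator

theorem norm_le_of_sq_le {ι : Type*} [Fintype ι] [DecidableEq ι] {A : Matrix ι ι ℝ}
    (hA : A.IsHermitian) {r : ℝ} (hr : 0 ≤ r) (hsq : A ^ 2 ≤ (r ^ 2) • 1) : ‖A‖ ≤ r := by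
  cases isEmpty_or_nonempty ι
  · rwa [Subsingleton.elim A 0, norm_zero]
  obtain ⟨x, hx, hxA : ‖x‖ = ‖A‖⟩ :=
    (IsometricContinuousFunctionalCalculus.isGreatest_norm_spectrum (𝕜 := ℝ) A hA.isSelfAdjoint).1
  rw [← Algebra.algebraMap_eq_smul_one,
    le_algebraMap_iff_spectrum_le (hA.isSelfAdjoint.pow 2)] at hsq
  rw [← hxA]
  exact abs_le_of_sq_le_sq (hsq _ (spectrum.pow_mem_pow A 2 hx)) hr

variable {κ : Type*}

/-- The symmetric dilation of a vector `z`: the matrix with off-diagonal blocks `zᵀ` and `z`, which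
reduces deviation bounds for random vectors to those for symmetric random matrices. -/
def vectorDilation : EuclideanSpace ℝ κ →ₗ[ℝ] Matrix (Unit ⊕ κ) (Unit ⊕ κ) ℝ where
  toFun z := fromBlocks 0 (replicateRow Unit z) (replicateCol Unit z) 0
  map_add' z w := by simp [fromBlocks_add]
  map_smul' a z := by simp [fromBlocks_smul]

theorem isHermitian_vectorDilation (z : EuclideanSpace ℝ κ) :
    (vectorDilation z).IsHermitian := by
  simp [vectorDilation, IsHermitian, conjTranspose_eq_transpose_of_trivial, fromBlocks_transpose]

variable [Fintype κ]

theorem vectorDilation_mulVec (z : EuclideanSpace ℝ κ) (w : Unit ⊕ κ → ℝ) :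
    vectorDilation z *ᵥ w = Sum.elim (fun _ => z ⬝ᵥ (w ∘ Sum.inr)) (w (Sum.inl ()) • z) := by
  ext (_ | i) <;> simp [vectorDilation, mulVec, dotProduct, mul_comm]

variable [DecidableEq κ]

theorem vectorDilation_sq_le (z : EuclideanSpace ℝ κ) : vectorDilation z ^ 2 ≤ (‖z‖ ^ 2) • 1 := by
  have hherm := isHermitian_vectorDilation z
  rw [Matrix.le_iff, posSemidef_iff_dotProduct_mulVec]
  refine ⟨(isHermitian_one.smul (IsSelfAdjoint.all _)).sub (hherm.pow 2), fun w => ?_⟩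
  have hquad : w ⬝ᵥ vectorDilation z ^ 2 *ᵥ w =
      (vectorDilation z *ᵥ w) ⬝ᵥ (vectorDilation z *ᵥ w) := by
    rw [pow_two, ← mulVec_mulVec, dotProduct_mulVec, ← mulVec_transpose,
      ← conjTranspose_eq_transpose_of_trivial, hherm.eq]
  have hcauchy : (z ⬝ᵥ (w ∘ Sum.inr)) ^ 2 ≤ (z ⬝ᵥ z) * ((w ∘ Sum.inr) ⬝ᵥ (w ∘ Sum.inr)) := by
    simpa only [dotProduct, sq] using Finset.sum_mul_sq_le_sq_mul_sq Finset.univ z (w ∘ Sum.inr)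
  have hnorm : ‖z‖ ^ 2 = z ⬝ᵥ z := by
    simp [EuclideanSpace.real_norm_sq_eq, dotProduct, ← sq]
  have hw : w ⬝ᵥ w = w (Sum.inl ()) ^ 2 + (w ∘ Sum.inr) ⬝ᵥ (w ∘ Sum.inr) := by
    simp [dotProduct, sq]
  rw [star_trivial, sub_mulVec, dotProduct_sub, hquad, vectorDilation_mulVec, sub_nonneg,
    Matrix.smul_mulVec, one_mulVec, dotProduct_smul, hw, hnorm, sumElim_dotProduct_sumElim]
  simp only [WithLp.ofLp_smul, dotProduct_smul, smul_dotProduct, smul_eq_mul]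
  rw [dotProduct, Finset.univ_unique, Finset.sum_singleton]
  linarith

theorem norm_vectorDilation (z : EuclideanSpace ℝ κ) : ‖vectorDilation z‖ = ‖z‖ := by
  refine le_antisymm (norm_le_of_sq_le (isHermitian_vectorDilation z) (norm_nonneg z)
    (vectorDilation_sq_le z)) ?_
  have := l2_opNorm_mulVec (vectorDilation z) (EuclideanSpace.single (Sum.inl ()) 1)
  rw [vectorDilation_mulVec] at this
  simpa [EuclideanSpace.norm_eq, dotProduct] using this

end VectorDilation

section VectorBernstein

open MeasureTheory ProbabilityTheory
open scoped MatrixOrder Matrix.Norms.L2Operator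

variable {κ Ω : Type*} [Fintype κ] [MeasurableSpace Ω] {μ : Measure Ω} [IsProbabilityMeasure μ]

theorem measureReal_le_norm_sum_vector_le {J : Type*} {z : J → Ω → EuclideanSpace ℝ κ}
    (hindep : iIndepFun z μ) (hz : ∀ j, Measurable (z j)) {U : ℝ} (hnorm : ∀ j ω, ‖z j ω‖ ≤ U)
    (hmean : ∀ j, ∫ ω, z j ω ∂μ = 0) {v : J → ℝ} (hsq : ∀ j, ∫ ω, ‖z j ω‖ ^ 2 ∂μ ≤ v j)
    (s : Finset J) {θ : ℝ} (hθ : 0 ≤ θ) (hθU : θ * U ≤ 1) (x : ℝ) :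
    μ.real {ω | x ≤ ‖∑ j ∈ s, z j ω‖} ≤
      2 * (Fintype.card κ + 1) * Real.exp (3 / 4 * θ ^ 2 * ∑ j ∈ s, v j - θ * x) := by
  classical
  let dil : EuclideanSpace ℝ κ →L[ℝ] Matrix (Unit ⊕ κ) (Unit ⊕ κ) ℝ :=
    vectorDilation.toContinuousLinearMap
  have hsq_dil (j) : ∫ ω, dil (z j ω) ^ 2 ∂μ ≤ v j • 1 := by
    refine (integral_mono (integrable_continuous_comp (hz j) (hnorm j) (f := fun y => dil y ^ 2)
      (by fun_prop)) (integrable_continuous_comp (hz j) (hnorm j)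
        (f := fun y => ‖y‖ ^ 2 • (1 : Matrix (Unit ⊕ κ) (Unit ⊕ κ) ℝ)) (by fun_prop))
      fun ω => vectorDilation_sq_le (z j ω)).trans ?_
    rw [integral_smul_const]
    exact smul_le_smul_of_nonneg_right (hsq j) zero_le_one
  have := measureReal_le_norm_sum_le (hindep.comp (fun _ => dil) fun _ => by fun_prop)
    (fun j => by fun_prop) (fun j ω => isHermitian_vectorDilation (z j ω))
    (fun j ω => (norm_vectorDilation _).trans_le (hnorm j ω))
    (fun j => by simp only [Function.comp, dil.integral_comp_comm
      (integrable_continuous_comp (hz j) (hnorm j) continuous_id'), hmean j, map_zero])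
    hsq_dil s hθ hθU x
  simpa [Function.comp, ← map_sum, dil, norm_vectorDilation, add_comm (1 : ℝ)] using this

theorem exists_bernstein_parameter {U V T : ℝ} (hU : 0 < U) (hV : 0 ≤ V) (hT : 0 ≤ T) :
    ∃ θ, 0 ≤ θ ∧ θ * U ≤ 1 ∧
      3 / 4 * θ ^ 2 * V - θ * (4 * √(T * V) + 4 * U * T) ≤ -(3 * T) := by
  rcases le_or_gt (U ^ 2 * T) V with hUV | hUV
  · have hθV : √(T / V) ^ 2 * V = T := by
      rw [Real.sq_sqrt (div_nonneg hT hV), div_mul_cancel_of_imp]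
      rintro rfl
      nlinarith [sq_pos_of_pos hU]
    have hsqrt : √(T * V) = √(T / V) * V := by
      rw [← Real.sqrt_sq (mul_nonneg (Real.sqrt_nonneg (T / V)) hV), mul_pow]
      congr 1
      linear_combination -V * hθV
    refine ⟨√(T / V), Real.sqrt_nonneg _, ?_, ?_⟩
    · rw [← abs_of_nonneg (mul_nonneg (Real.sqrt_nonneg (T / V)) hU.le), ← sq_le_one_iff_abs_le_one,
        mul_pow, Real.sq_sqrt (div_nonneg hT hV), div_mul_eq_mul_div, mul_comm T]
      exact div_le_one_of_le₀ hUV hV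
    · rw [hsqrt]
      nlinarith [mul_nonneg (mul_nonneg (Real.sqrt_nonneg (T / V)) hU.le) hT]
  · refine ⟨U⁻¹, by positivity, (inv_mul_cancel₀ hU.ne').le, ?_⟩
    have hVT : U⁻¹ ^ 2 * V ≤ T := by
      rw [inv_pow, inv_mul_le_iff₀ (by positivity)]
      exact hUV.le
    have hUT : U⁻¹ * (U * T) = T := inv_mul_cancel_left₀ hU.ne' T
    nlinarith [mul_nonneg (inv_nonneg.2 hU.le) (Real.sqrt_nonneg (T * V))]

theorem measureReal_lt_norm_sum_le {J : Type*} {z : J → Ω → EuclideanSpace ℝ κ}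
    (hindep : iIndepFun z μ) (hz : ∀ j, Measurable (z j)) {U : ℝ} (hU : 0 ≤ U)
    (hnorm : ∀ j ω, ‖z j ω‖ ≤ U) (hmean : ∀ j, ∫ ω, z j ω ∂μ = 0) {v : J → ℝ}
    (hsq : ∀ j, ∫ ω, ‖z j ω‖ ^ 2 ∂μ ≤ v j) (s : Finset J) {T : ℝ} (hT : 0 ≤ T) :
    μ.real {ω | 4 * √(T * ∑ j ∈ s, v j) + 4 * U * T < ‖∑ j ∈ s, z j ω‖} ≤
      2 * (Fintype.card κ + 1) * Real.exp (-(3 * T)) := by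
  rcases hU.eq_or_lt with rfl | hU
  · have hz0 (j ω) : z j ω = 0 := norm_le_zero_iff.1 (hnorm j ω)
    simp only [hz0, Finset.sum_const_zero, norm_zero, mul_zero, zero_mul, add_zero,
      (show 0 ≤ 4 * √(T * ∑ j ∈ s, v j) by positivity).not_gt, Set.ofPred_false, measureReal_empty]
    positivity
  · have hV : 0 ≤ ∑ j ∈ s, v j :=
      Finset.sum_nonneg fun j _ => (integral_nonneg fun ω => sq_nonneg ‖z j ω‖).trans (hsq j)
    obtain ⟨θ, hθ, hθU, hexponent⟩ := exists_bernstein_parameter hU hV hT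
    set x := 4 * √(T * ∑ j ∈ s, v j) + 4 * U * T
    calc
      μ.real {ω | x < ‖∑ j ∈ s, z j ω‖} ≤ μ.real {ω | x ≤ ‖∑ j ∈ s, z j ω‖} :=
        measureReal_mono fun _ (h : x < _) => h.le
      _ ≤ 2 * (Fintype.card κ + 1) * Real.exp (3 / 4 * θ ^ 2 * ∑ j ∈ s, v j - θ * x) :=
        measureReal_le_norm_sum_vector_le hindep hz hnorm hmean hsq s hθ hθU x
      _ ≤ 2 * (Fintype.card κ + 1) * Real.exp (-(3 * T)) := by gcongr

end VectorBernstein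

section NuclearNorm

open Matrix
open scoped MatrixOrder

variable {V : Type*} [Fintype V]

theorem SymKernel.isHermitian (S : SymKernel V) : (S : Matrix V V ℝ).IsHermitian := S.2

variable [DecidableEq V]

theorem continuousOn_spectrum (f : ℝ → ℝ) (A : Matrix V V ℝ) : ContinuousOn f (spectrum ℝ A) :=
  A.finite_real_spectrum.continuousOn f

/-- The matrix sign of a symmetric kernel, which is a subgradient of the nuclear norm at `S`. -/
noncomputable def signKernel (S : SymKernel V) : Matrix V V ℝ := cfc Real.sign (S : Matrix V V ℝ)

/-- The matrix of the orthogonal projector onto the support of a symmetric kernel, obtained by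
functional calculus. -/
noncomputable def supportProj (S : SymKernel V) : Matrix V V ℝ :=
  cfc (fun x : ℝ => if x = 0 then 0 else 1) (S : Matrix V V ℝ)

variable (S : SymKernel V)

theorem isHermitian_signKernel : (signKernel S).IsHermitian := cfc_predicate _ _

theorem isHermitian_supportProj : (supportProj S).IsHermitian := cfc_predicate _ _

theorem signKernel_mul_self : signKernel S * signKernel S = supportProj S := by
  rw [signKernel, ← cfc_mul _ _ _ (continuousOn_spectrum _ _) (continuousOn_spectrum _ _),
    supportProj]
  congr 1 with x
  rcases lt_trichotomy x 0 with h | h | h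
  · simp [Real.sign_of_neg h, h.ne]
  · simp [h]
  · simp [Real.sign_of_pos h, h.ne']

theorem supportProj_mul_self : supportProj S * supportProj S = supportProj S := by
  rw [supportProj, ← cfc_mul _ _ _ (continuousOn_spectrum _ _) (continuousOn_spectrum _ _)]
  congr 1 with x
  split_ifs <;> simp

theorem mul_supportProj : (S : Matrix V V ℝ) * supportProj S = S :=
  calc
    (S : Matrix V V ℝ) * supportProj S = cfc (fun x : ℝ => x) (S : Matrix V V ℝ) *
        cfc (fun x : ℝ => if x = 0 then 0 else 1) (S : Matrix V V ℝ) :=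
      congrArg (· * supportProj S) (cfc_id' ℝ (S : Matrix V V ℝ) S.2).symm
    _ = cfc (fun x : ℝ => x) (S : Matrix V V ℝ) := by
      rw [← cfc_mul _ _ _ (continuousOn_spectrum _ _) (continuousOn_spectrum _ _)]
      congr 1 with x
      split_ifs with hx <;> simp [hx]
    _ = S := cfc_id' ℝ (S : Matrix V V ℝ) S.2

theorem signKernel_mul_supportProj : signKernel S * supportProj S = signKernel S := by
  rw [signKernel, supportProj,
    ← cfc_mul _ _ _ (continuousOn_spectrum _ _) (continuousOn_spectrum _ _)]
  congr 1 with x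
  split_ifs with hx <;> simp [hx]

theorem signKernel_le_supportProj : signKernel S ≤ supportProj S :=
  cfc_mono (fun x _ => by
    rcases lt_trichotomy x 0 with h | rfl | h
    · simp [Real.sign_of_neg h, h.ne]
    · simp
    · simp [Real.sign_of_pos h, h.ne']) (continuousOn_spectrum _ _) (continuousOn_spectrum _ _)

theorem neg_supportProj_le_signKernel : -supportProj S ≤ signKernel S := by
  rw [supportProj, ← cfc_neg]
  exact cfc_mono (fun x _ => by
    rcases lt_trichotomy x 0 with h | rfl | h
    · simp [Real.sign_of_neg h, h.ne]
    · simp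
    · simp [Real.sign_of_pos h, h.ne']) (continuousOn_spectrum _ _) (continuousOn_spectrum _ _)

theorem supportProj_nonneg : 0 ≤ supportProj S :=
  cfc_nonneg fun x _ => by split_ifs <;> simp

theorem supportProj_le_one : supportProj S ≤ 1 :=
  cfc_le_one _ _ fun x _ => by split_ifs <;> simp

theorem trace_cfc_abs : (cfc (fun x : ℝ => |x|) (S : Matrix V V ℝ)).trace = nuclearNorm S :=
  trace_cfc S.isHermitian _

theorem trace_mul_signKernel : ((S : Matrix V V ℝ) * signKernel S).trace = nuclearNorm S :=
  calc
    ((S : Matrix V V ℝ) * signKernel S).trace =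
        (cfc (fun x : ℝ => x) (S : Matrix V V ℝ) * cfc Real.sign (S : Matrix V V ℝ)).trace :=
      congrArg (fun A => (A * signKernel S).trace) (cfc_id' ℝ (S : Matrix V V ℝ) S.2).symm
    _ = (cfc (fun x : ℝ => |x|) (S : Matrix V V ℝ)).trace := by
      rw [← cfc_mul _ _ _ (continuousOn_spectrum _ _) (continuousOn_spectrum _ _)]
      congr 2 with x
      rcases lt_trichotomy x 0 with h | rfl | h
      · simp [Real.sign_of_neg h, abs_of_neg h]
      · simp
      · simp [Real.sign_of_pos h, abs_of_pos h]
    _ = nuclearNorm S := trace_cfc_abs S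

theorem trace_mul_le_mul_nuclearNorm {M : Matrix V V ℝ} {r : ℝ} (hneg : -(r • 1) ≤ M)
    (hle : M ≤ r • 1) : ((S : Matrix V V ℝ) * M).trace ≤ r * nuclearNorm S := by
  set A := cfc (fun x : ℝ => |x|) (S : Matrix V V ℝ) with hA
  have hid : cfc (fun x : ℝ => x) (S : Matrix V V ℝ) = S := cfc_id' ℝ (S : Matrix V V ℝ) S.2
  have hleA : (S : Matrix V V ℝ) ≤ A := by
    conv_lhs => rw [← hid]
    exact cfc_mono fun x _ => le_abs_self x
  have hnegA : -A ≤ (S : Matrix V V ℝ) := by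
    conv_rhs => rw [← hid]
    rw [hA, ← cfc_neg]
    exact cfc_mono fun x _ => neg_abs_le x
  have hplus := trace_mul_le_trace_mul_right (sub_nonneg.2 hnegA) hle
  have hminus := trace_mul_le_trace_mul_right (sub_nonneg.2 hleA) hneg
  simp only [sub_mul, mul_neg, sub_neg_eq_add, add_mul, trace_add, trace_sub, trace_neg,
    mul_smul_comm, mul_one, trace_smul, smul_eq_mul, hA, trace_cfc_abs] at hplus hminus
  linarith

theorem nuclearNorm_smul_add_smul_le (S₀ S₁ : SymKernel V) {a b : ℝ} (ha : 0 ≤ a) (hb : 0 ≤ b) :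
    nuclearNorm (a • S₁ + b • S₀) ≤ a * nuclearNorm S₁ + b * nuclearNorm S₀ := by
  set G := signKernel (a • S₁ + b • S₀)
  have hneg : -((1 : ℝ) • 1) ≤ G := by
    rw [one_smul]
    exact (neg_le_neg (supportProj_le_one _)).trans (neg_supportProj_le_signKernel _)
  have hle : G ≤ (1 : ℝ) • 1 := by
    rw [one_smul]
    exact (signKernel_le_supportProj _).trans (supportProj_le_one _)
  have h₁ := trace_mul_le_mul_nuclearNorm S₁ hneg hle
  have h₀ := trace_mul_le_mul_nuclearNorm S₀ hneg hle
  rw [one_mul] at h₁ h₀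
  calc
    nuclearNorm (a • S₁ + b • S₀) = (((a • S₁ + b • S₀ : SymKernel V) : Matrix V V ℝ) * G).trace :=
      (trace_mul_signKernel _).symm
    _ = a * ((S₁ : Matrix V V ℝ) * G).trace + b * ((S₀ : Matrix V V ℝ) * G).trace := by
      simp [add_mul]
    _ ≤ a * nuclearNorm S₁ + b * nuclearNorm S₀ := by gcongr

/-- The subdifferential of `r • ‖·‖₁` at `S₀` contains the matrices `r • sign S₀ + Q * M * Q` with
`Q` the projector onto the orthogonal complement of the support and `‖Q * M * Q‖ ≤ r`. -/
theorem trace_sub_mul_le_nuclearNorm_sub (S₀ S₁ : SymKernel V) {M Q : Matrix V V ℝ} {r : ℝ}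
    (hQ : Q = 1 - supportProj S₀) (hr : 0 ≤ r) (hneg : -(r • 1) ≤ Q * M * Q)
    (hle : Q * M * Q ≤ r • 1) :
    (((S₁ : Matrix V V ℝ) - S₀) * (r • signKernel S₀ + Q * M * Q)).trace ≤
      r * (nuclearNorm S₁ - nuclearNorm S₀) := by
  have hQsa : IsSelfAdjoint Q := hQ ▸ (isHermitian_one.sub (isHermitian_supportProj S₀))
  have hQQ : Q * Q = Q := by
    simp only [hQ, sub_mul, mul_sub, one_mul, mul_one, supportProj_mul_self, sub_self, sub_zero]
  have hSQ : (S₀ : Matrix V V ℝ) * Q = 0 := by rw [hQ, mul_sub, mul_one, mul_supportProj, sub_self]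
  have hconj : Q * (Q * M * Q) * Q = Q * M * Q := by
    rw [← mul_assoc, ← mul_assoc, hQQ, mul_assoc _ Q Q, hQQ]
  have hle_Q : Q * M * Q ≤ r • Q := by
    simpa only [hconj, mul_smul_comm, smul_mul_assoc, mul_one, hQQ] using
      hQsa.conjugate_le_conjugate hle
  have hneg_Q : -(r • Q) ≤ Q * M * Q := by
    simpa only [hconj, mul_neg, neg_mul, mul_smul_comm, smul_mul_assoc, mul_one, hQQ] using
      hQsa.conjugate_le_conjugate hneg
  have hone : r • (1 : Matrix V V ℝ) = r • supportProj S₀ + r • Q := by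
    rw [← smul_add, hQ, add_sub_cancel]
  have hsub := trace_mul_le_mul_nuclearNorm S₁ (M := r • signKernel S₀ + Q * M * Q) (r := r)
    (by
      rw [hone, neg_add, ← smul_neg]
      exact add_le_add (smul_le_smul_of_nonneg_left (neg_supportProj_le_signKernel S₀) hr) hneg_Q)
    (by
      rw [hone]
      exact add_le_add (smul_le_smul_of_nonneg_left (signKernel_le_supportProj S₀) hr) hle_Q)
  have hself : ((S₀ : Matrix V V ℝ) * (r • signKernel S₀ + Q * M * Q)).trace =
      r * nuclearNorm S₀ := by
    rw [mul_add, mul_smul_comm, ← mul_assoc, ← mul_assoc, hSQ, zero_mul, zero_mul, add_zero,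
      trace_smul, trace_mul_signKernel, smul_eq_mul]
  rw [sub_mul, trace_sub, hself]
  linarith

end NuclearNorm

section SupportProjection

open Matrix

variable {V : Type*} [Fintype V] [DecidableEq V]

theorem cfc_mulVec_eigenvectorBasis {A : Matrix V V ℝ} (hA : A.IsHermitian) (f : ℝ → ℝ) (i : V) :
    cfc f A *ᵥ hA.eigenvectorBasis i = f (hA.eigenvalues i) • (hA.eigenvectorBasis i).ofLp := by
  rw [hA.cfc_eq, IsHermitian.cfc, Unitary.conjStarAlgAut_apply, ← mulVec_mulVec, ← mulVec_mulVec,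
    hA.star_eigenvectorUnitary_mulVec, diagonal_mulVec_single, mul_one,
    ← hA.eigenvectorUnitary_mulVec, ← mulVec_smul, ← Pi.single_smul, smul_eq_mul, mul_one]
  rfl

theorem eigenvectorBasis_mem_kernelSupport (S : SymKernel V) {i : V}
    (hi : S.isHermitian.eigenvalues i ≠ 0) :
    S.isHermitian.eigenvectorBasis i ∈ kernelSupport S :=
  Submodule.subset_span ⟨_, hi, WithLp.ofLp_injective 2 (S.isHermitian.mulVec_eigenvectorBasis i)⟩

theorem eigenvectorBasis_mem_kernelSupport_orthogonal (S : SymKernel V) {i : V}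
    (hi : S.isHermitian.eigenvalues i = 0) :
    S.isHermitian.eigenvectorBasis i ∈ (kernelSupport S)ᗮ := by
  have hsymm := isSymmetric_toEuclideanLin_iff.2 S.isHermitian
  have hker : toEuclideanLin (S : Matrix V V ℝ) (S.isHermitian.eigenvectorBasis i) = 0 := by
    refine WithLp.ofLp_injective 2 ((S.isHermitian.mulVec_eigenvectorBasis i).trans ?_)
    rw [hi, zero_smul, WithLp.ofLp_zero]
  suffices kernelSupport S ≤ (ℝ ∙ S.isHermitian.eigenvectorBasis i)ᗮ from
    (Submodule.mem_orthogonal' _ _).2 fun w hw =>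
      Submodule.mem_orthogonal_singleton_iff_inner_right.1 (this hw)
  refine Submodule.span_le.2 ?_
  rintro ψ ⟨σ, hσ, hψ⟩
  have := hsymm (S.isHermitian.eigenvectorBasis i) ψ
  rw [hker, hψ, inner_zero_left, inner_smul_right, zero_eq_mul, or_iff_right hσ] at this
  exact Submodule.mem_orthogonal_singleton_iff_inner_right.2 this

theorem toEuclideanLin_supportProj (S : SymKernel V) :
    toEuclideanLin (supportProj S) = (kernelSupport S).starProjection.toLinearMap := by
  refine S.isHermitian.eigenvectorBasis.toBasis.ext fun i => ?_
  have happly : toEuclideanLin (supportProj S) (S.isHermitian.eigenvectorBasis i) =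
      (if S.isHermitian.eigenvalues i = 0 then 0 else 1 : ℝ) • S.isHermitian.eigenvectorBasis i :=
    WithLp.ofLp_injective 2 (cfc_mulVec_eigenvectorBasis S.isHermitian _ i)
  rw [OrthonormalBasis.coe_toBasis, happly, ContinuousLinearMap.coe_coe]
  split_ifs with hi
  · rw [zero_smul, Submodule.starProjection_apply_eq_zero_iff _ |>.2
      (eigenvectorBasis_mem_kernelSupport_orthogonal S hi)]
  · rw [one_smul, Submodule.starProjection_eq_self_iff.2 (eigenvectorBasis_mem_kernelSupport S hi)]

theorem norm_sq_kernelSupport_starProjection (S : SymKernel V) (x : EuclideanSpace ℝ V) :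
    ‖(kernelSupport S).starProjection x‖ ^ 2 = x ⬝ᵥ supportProj S *ᵥ x := by
  rw [← real_inner_self_eq_norm_sq, Submodule.inner_starProjection_left_eq_right,
    Submodule.starProjection_eq_self_iff.2 (Submodule.starProjection_apply_mem _ _),
    show (kernelSupport S).starProjection x = toEuclideanLin (supportProj S) x from
      congrArg (· x) (toEuclideanLin_supportProj S).symm]
  simp [EuclideanSpace.inner_eq_star_dotProduct, toEuclideanLin, dotProduct_comm]

end SupportProjection

section OracleInequality

open Matrix
open scoped MatrixOrder Matrix.Norms.L2Operator

variable {V : Type*} [Fintype V]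

theorem SymKernel.transpose_eq (S : SymKernel V) : (S : Matrix V V ℝ)ᵀ = S :=
  (conjTranspose_eq_transpose_of_trivial _).symm.trans S.isHermitian.eq

theorem l2NormSq_eq_trace (A : Matrix V V ℝ) :
    l2NormSq A = (Aᵀ * A).trace / (Fintype.card V : ℝ) ^ 2 := by
  simp only [l2NormSq, trace, diag_apply, mul_apply, transpose_apply, sq_abs, ← sq]
  rw [Finset.sum_comm]

theorem trace_mul_mul_comm {A B C : Matrix V V ℝ} (hA : Aᵀ = A) (hB : Bᵀ = B) (hC : Cᵀ = C) :
    (A * B * C).trace = (C * B * A).trace := by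
  rw [← trace_transpose, transpose_mul, transpose_mul, hA, hB, hC, mul_assoc]

theorem trace_sub_mul_mul_sub_transpose {B : Matrix V V ℝ} (hB : Bᵀ = B) (A C : Matrix V V ℝ) :
    ((A - C) * B * (A - C)ᵀ).trace =
      (A * B * Aᵀ).trace - 2 * (C * B * Aᵀ).trace + (C * B * Cᵀ).trace := by
  have hcross : (A * B * Cᵀ).trace = (C * B * Aᵀ).trace := by
    rw [← trace_transpose, transpose_mul, transpose_mul, transpose_transpose, hB, mul_assoc]
  simp only [sub_mul, mul_sub, transpose_sub, trace_sub, hcross]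
  ring

theorem trace_mul_mul_transpose_nonneg {B : Matrix V V ℝ} (hB : 0 ≤ B) (A : Matrix V V ℝ) :
    0 ≤ (A * B * Aᵀ).trace := by
  rw [← conjTranspose_eq_transpose_of_trivial]
  exact ((nonneg_iff_posSemidef.1 hB).mul_mul_conjTranspose_same A).trace_nonneg

theorem trace_sub_mul_mul_sub_transpose_le {B : Matrix V V ℝ} (hB : 0 ≤ B) (A C : Matrix V V ℝ) :
    ((A - C) * B * (A - C)ᵀ).trace ≤ 2 * (A * B * Aᵀ).trace + 2 * (C * B * Cᵀ).trace := by
  have hBt : Bᵀ = B :=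
    (conjTranspose_eq_transpose_of_trivial _).symm.trans (IsSelfAdjoint.of_nonneg hB)
  have hadd := trace_mul_mul_transpose_nonneg hB (A + C)
  have hsub := trace_sub_mul_mul_sub_transpose hBt A (-C)
  rw [sub_neg_eq_add] at hsub
  rw [trace_sub_mul_mul_sub_transpose hBt]
  simp only [neg_mul, transpose_neg, mul_neg, neg_neg, trace_neg] at hsub
  linarith

variable [DecidableEq V]

theorem two_mul_trace_mul_transpose_le {B : Matrix V V ℝ} (hB : B.PosDef) {τ : ℝ} (hτ : 0 < τ)
    (A C : Matrix V V ℝ) :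
    2 * (C * Aᵀ).trace ≤ τ * (A * B * Aᵀ).trace + τ⁻¹ * (C * B⁻¹ * Cᵀ).trace := by
  have hBt : Bᵀ = B := (conjTranspose_eq_transpose_of_trivial _).symm.trans hB.isHermitian
  have hunit : IsUnit B.det := (isUnit_iff_isUnit_det B).1 hB.isUnit
  have hnonneg := trace_mul_mul_transpose_nonneg hB.posSemidef.nonneg (A - τ⁻¹ • (C * B⁻¹))
  rw [trace_sub_mul_mul_sub_transpose hBt] at hnonneg
  have hcancel : C * B⁻¹ * B = C := by rw [mul_assoc, nonsing_inv_mul B hunit, mul_one]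
  simp only [smul_mul_assoc, hcancel, transpose_smul, transpose_mul, transpose_nonsing_inv, hBt,
    mul_smul_comm, trace_smul, smul_eq_mul, ← mul_assoc] at hnonneg
  have := mul_nonneg hτ.le hnonneg
  field_simp at this ⊢
  linarith

theorem sqrtMatrix_transpose (W : Matrix V V ℝ) : (sqrtMatrix W)ᵀ = sqrtMatrix W :=
  (conjTranspose_eq_transpose_of_trivial _).symm.trans
    (IsSelfAdjoint.of_nonneg (CFC.sqrt_nonneg W))

theorem l2NormSq_sqrtMatrix_mul {W : Matrix V V ℝ} (hW : 0 ≤ W) (S : SymKernel V) :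
    l2NormSq (sqrtMatrix W * (S : Matrix V V ℝ)) =
      ((S : Matrix V V ℝ) * W * S).trace / (Fintype.card V : ℝ) ^ 2 := by
  rw [l2NormSq_eq_trace, transpose_mul, S.transpose_eq, sqrtMatrix_transpose, ← mul_assoc,
    mul_assoc (S : Matrix V V ℝ), sqrtMatrix, CFC.sqrt_mul_sqrt_self W]

/-- The symmetrized matrix unit `(e_u ⊗ e_v + e_v ⊗ e_u) / 2`, whose inner product with a symmetric
kernel is the value of the kernel at `(u, v)`. -/
noncomputable def symUnit {V : Type*} [DecidableEq V] (u v : V) : Matrix V V ℝ :=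
  (1 / 2 : ℝ) • (single u v 1 + single v u 1)

theorem symUnit_transpose {V : Type*} [DecidableEq V] (u v : V) : (symUnit u v)ᵀ = symUnit u v := by
  rw [symUnit, transpose_smul, transpose_add, transpose_single, transpose_single, add_comm]

theorem trace_mul_symUnit (S : SymKernel V) (u v : V) :
    ((S : Matrix V V ℝ) * symUnit u v).trace = (S : Matrix V V ℝ) u v := by
  have hsymm : (S : Matrix V V ℝ) v u = (S : Matrix V V ℝ) u v := congrFun₂ S.transpose_eq u v
  simp only [symUnit, mul_smul_comm, trace_smul, mul_add, trace_add, trace_mul_single, hsymm,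
    smul_eq_mul, MulOpposite.op_one, one_smul]
  ring

/-- The symmetrized empirical matrix `n⁻¹ ∑ⱼ yⱼ (e_{xⱼ} ⊗ e_{xⱼ'})`, which represents the linear
part of the empirical risk. -/
noncomputable def empiricalKernel {V : Type*} [DecidableEq V] {n : ℕ} (x x' : Fin n → V)
    (y : Fin n → ℝ) : Matrix V V ℝ :=
  (n : ℝ)⁻¹ • ∑ j, y j • symUnit (x j) (x' j)

theorem empiricalKernel_transpose {V : Type*} [DecidableEq V] {n : ℕ} (x x' : Fin n → V)
    (y : Fin n → ℝ) : (empiricalKernel x x' y)ᵀ = empiricalKernel x x' y := by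
  simp only [empiricalKernel, transpose_smul, transpose_sum, symUnit_transpose]

/-- The noise matrix of a sample: the deviation of the empirical kernel from its expectation
`m⁻² S`. -/
noncomputable def noiseKernel (S : SymKernel V) {n : ℕ} (x x' : Fin n → V) (y : Fin n → ℝ) :
    Matrix V V ℝ :=
  empiricalKernel x x' y - ((Fintype.card V : ℝ) ^ 2)⁻¹ • (S : Matrix V V ℝ)

theorem noiseKernel_transpose (S : SymKernel V) {n : ℕ} (x x' : Fin n → V) (y : Fin n → ℝ) :
    (noiseKernel S x x' y)ᵀ = noiseKernel S x x' y := by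
  rw [noiseKernel, transpose_sub, transpose_smul, S.transpose_eq, empiricalKernel_transpose]

/-- The compression `P_L (1 + ε' W)⁻¹ P_L` of the resolvent of the smoothness penalty to the support
`L` of `S`; its trace is the effective dimension in the oracle inequality. -/
noncomputable def supportResolvent (W : Matrix V V ℝ) (ε' : ℝ) (S : SymKernel V) : Matrix V V ℝ :=
  supportProj S * (1 + ε' • W)⁻¹ * supportProj S

theorem supportProj_transpose (S : SymKernel V) : (supportProj S)ᵀ = supportProj S :=
  (conjTranspose_eq_transpose_of_trivial _).symm.trans (isHermitian_supportProj S)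

theorem supportResolvent_nonneg {W : Matrix V V ℝ} (hW : 0 ≤ W) {ε' : ℝ} (hε' : 0 ≤ ε')
    (S : SymKernel V) : 0 ≤ supportResolvent W ε' S := by
  have hpos := (PosDef.one.add_posSemidef (hW.posSemidef.smul hε')).inv.posSemidef
  simpa only [supportResolvent, (isHermitian_supportProj S).eq] using
    (hpos.mul_mul_conjTranspose_same (supportProj S)).nonneg

theorem supportProj_mul_supportResolvent (W : Matrix V V ℝ) (ε' : ℝ) (S : SymKernel V) :
    supportProj S * supportResolvent W ε' S = supportResolvent W ε' S := by
  simp only [supportResolvent, ← mul_assoc, supportProj_mul_self]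

variable {W : Matrix V V ℝ} {ε ε' : ℝ} {n : ℕ} {x x' : Fin n → V} {y : Fin n → ℝ}

theorem penalizedRisk_eq (hW : 0 ≤ W) (S : SymKernel V) :
    penalizedRisk W ε ε' x x' y S =
      ((S : Matrix V V ℝ) * (1 + ε' • W) * (S : Matrix V V ℝ)ᵀ).trace / (Fintype.card V : ℝ) ^ 2
        - 2 * ((S : Matrix V V ℝ) * empiricalKernel x x' y).trace + ε * nuclearNorm S := by
  have hlinear : ((S : Matrix V V ℝ) * empiricalKernel x x' y).trace =
      (n : ℝ)⁻¹ * ∑ j, y j * (S : Matrix V V ℝ) (x j) (x' j) := by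
    simp only [empiricalKernel, Matrix.mul_sum, mul_smul_comm, trace_smul, trace_sum,
      trace_mul_symUnit, smul_eq_mul]
  simp only [penalizedRisk, l2NormSq_sqrtMatrix_mul hW, l2NormSq_eq_trace, S.transpose_eq, hlinear,
    mul_add, add_mul, mul_one, mul_smul_comm, smul_mul_assoc, trace_add, trace_smul, smul_eq_mul]
  ring

theorem nonpos_of_forall_le_mul {a q : ℝ} (h : ∀ τ, 0 < τ → τ ≤ 1 → a ≤ τ * q) : a ≤ 0 := by
  have hlim : Filter.Tendsto (fun τ : ℝ => τ * q) (nhdsWithin 0 (Set.Ioi 0)) (nhds 0) := by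
    simpa using (Filter.tendsto_id.mul_const q).mono_left (nhdsWithin_le_nhds (a := (0 : ℝ)))
  refine ge_of_tendsto hlim ?_
  filter_upwards [Ioc_mem_nhdsGT one_pos] with τ hτ using h τ hτ.1 hτ.2

theorem trace_sub_mul_add_nuclearNorm_sub_le_of_isMinOn (hW : 0 ≤ W) (hε : 0 ≤ ε)
    {D : Set (SymKernel V)} (hD : Convex ℝ D) {S₀ S₁ : SymKernel V} (h₀ : S₀ ∈ D) (h₁ : S₁ ∈ D)
    (hmin : IsMinOn (penalizedRisk W ε ε' x x' y) D S₁) :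
    2 * (((S₁ : Matrix V V ℝ) - S₀) * (1 + ε' • W) * S₁).trace / (Fintype.card V : ℝ) ^ 2
      - 2 * (((S₁ : Matrix V V ℝ) - S₀) * empiricalKernel x x' y).trace
      + ε * (nuclearNorm S₁ - nuclearNorm S₀) ≤ 0 := by
  set B := 1 + ε' • W with hB
  have hBt : Bᵀ = B := by
    rw [hB, transpose_add, transpose_smul, transpose_one,
      (conjTranspose_eq_transpose_of_trivial W).symm.trans (IsSelfAdjoint.of_nonneg hW)]
  set Δ := (S₁ : Matrix V V ℝ) - S₀ with hΔ
  refine nonpos_of_forall_le_mul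
    (q := (Δ * B * Δᵀ).trace / (Fintype.card V : ℝ) ^ 2) fun τ hτ hτ1 => ?_
  have hrisk := isMinOn_iff.1 hmin _ (hD h₁ h₀ (sub_nonneg.2 hτ1) hτ.le (sub_add_cancel 1 τ))
  have hsegment : (((1 - τ) • S₁ + τ • S₀ : SymKernel V) : Matrix V V ℝ) =
      (S₁ : Matrix V V ℝ) - τ • Δ := by
    rw [AddSubgroup.coe_add, selfAdjoint.val_smul, selfAdjoint.val_smul, hΔ]
    module
  have hnuc := mul_le_mul_of_nonneg_left
    (nuclearNorm_smul_add_smul_le S₀ S₁ (sub_nonneg.2 hτ1) hτ.le) hε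
  rw [penalizedRisk_eq hW, penalizedRisk_eq hW, hsegment, ← hB,
    trace_sub_mul_mul_sub_transpose hBt] at hrisk
  simp only [sub_mul, trace_sub, smul_mul_assoc, trace_smul, smul_eq_mul, transpose_smul,
    mul_smul_comm, S₁.transpose_eq] at hrisk
  refine le_of_mul_le_mul_left ?_ hτ
  linear_combination hrisk + hnuc

theorem basic_inequality_of_isMinOn (hW : 0 ≤ W) (hε : 0 ≤ ε) (hε' : 0 ≤ ε')
    {D : Set (SymKernel V)} (hD : Convex ℝ D) {S₀ S₁ : SymKernel V} (h₀ : S₀ ∈ D) (h₁ : S₁ ∈ D)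
    (hmin : IsMinOn (penalizedRisk W ε ε' x x' y) D S₁) {Δ : Matrix V V ℝ}
    (hΔ : Δ = (S₁ : Matrix V V ℝ) - S₀) :
    ((Δ * Δᵀ).trace + (Δ * (1 + ε' • W) * Δᵀ).trace) / (Fintype.card V : ℝ) ^ 2 ≤
      ε' * l2NormSq (sqrtMatrix W * (S₀ : Matrix V V ℝ)) +
        2 * (Δ * noiseKernel S₀ x x' y).trace - ε * (nuclearNorm S₁ - nuclearNorm S₀) := by
  have hWt : Wᵀ = W :=
    (conjTranspose_eq_transpose_of_trivial W).symm.trans (IsSelfAdjoint.of_nonneg hW)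
  have hΔt : Δᵀ = Δ := by rw [hΔ, transpose_sub, S₁.transpose_eq, S₀.transpose_eq]
  have hopt := trace_sub_mul_add_nuclearNorm_sub_le_of_isMinOn hW hε hD h₀ h₁ hmin
  have hS₁ : 0 ≤ ((S₁ : Matrix V V ℝ) * W * (S₁ : Matrix V V ℝ)ᵀ).trace :=
    trace_mul_mul_transpose_nonneg hW _
  have hS₁eq : (S₁ : Matrix V V ℝ) = S₀ + Δ := by rw [hΔ, add_sub_cancel]
  have hcross := trace_mul_mul_comm S₀.transpose_eq hWt hΔt
  rw [l2NormSq_sqrtMatrix_mul hW, noiseKernel, hΔt]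
  rw [← hΔ] at hopt
  simp only [hS₁eq, transpose_add, hΔt, S₀.transpose_eq, mul_add, add_mul, mul_one, mul_smul_comm,
    smul_mul_assoc, trace_add, trace_smul, smul_eq_mul, hcross, mul_sub, trace_sub] at hopt hS₁ ⊢
  have := div_nonneg (mul_nonneg hε' hS₁) (sq_nonneg (Fintype.card V : ℝ))
  linear_combination hopt + this

theorem le_smul_one_of_norm_le {A : Matrix V V ℝ} (hA : A.IsHermitian) {r : ℝ} (hr : ‖A‖ ≤ r) :
    A ≤ r • 1 := by
  rw [← Algebra.algebraMap_eq_smul_one, le_algebraMap_iff_spectrum_le hA.isSelfAdjoint]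
  exact fun x hx => (le_abs_self x).trans ((IsometricContinuousFunctionalCalculus.norm_spectrum_le
    A hx hA.isSelfAdjoint).trans hr)

theorem neg_smul_one_le_of_norm_le {A : Matrix V V ℝ} (hA : A.IsHermitian) {r : ℝ}
    (hr : ‖A‖ ≤ r) : -(r • 1) ≤ A :=
  neg_le.1 (le_smul_one_of_norm_le hA.neg ((norm_neg A).trans_le hr))

theorem trace_noise_le (hε : 0 ≤ ε) {S₀ S₁ : SymKernel V} {Δ Ξ P Q : Matrix V V ℝ}
    (hΔ : Δ = (S₁ : Matrix V V ℝ) - S₀) (hΞt : Ξᵀ = Ξ) (hP : P = supportProj S₀) (hQ : Q = 1 - P)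
    (hnoise : ‖Q * Ξ * Q‖ ≤ ε / 2) :
    2 * (Δ * Ξ).trace - ε * (nuclearNorm S₁ - nuclearNorm S₀) ≤
      (((2 : ℝ) • ((1 + Q) * Ξ) - ε • signKernel S₀) * P * Δᵀ).trace := by
  have hΔt : Δᵀ = Δ := by rw [hΔ, transpose_sub, S₁.transpose_eq, S₀.transpose_eq]
  have hPt : Pᵀ = P := hP ▸ supportProj_transpose S₀
  have hQt : Qᵀ = Q := by rw [hQ, transpose_sub, transpose_one, hPt]
  have hherm : (Q * ((2 : ℝ) • Ξ) * Q).IsHermitian := by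
    rw [IsHermitian, conjTranspose_eq_transpose_of_trivial]
    simp only [transpose_mul, hQt, transpose_smul, hΞt, mul_assoc]
  have hnorm : ‖Q * ((2 : ℝ) • Ξ) * Q‖ ≤ ε := by
    rw [mul_smul_comm, smul_mul_assoc, norm_smul, Real.norm_two]
    linarith
  have hsub := trace_sub_mul_le_nuclearNorm_sub S₀ S₁ (M := (2 : ℝ) • Ξ) (hP ▸ hQ) hε
    (neg_smul_one_le_of_norm_le hherm hnorm) (le_smul_one_of_norm_le hherm hnorm)
  have hsign : signKernel S₀ * P = signKernel S₀ := hP ▸ signKernel_mul_supportProj S₀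
  have hsupport : ((1 + Q) * Ξ * P * Δ).trace = (Δ * Ξ).trace - (Δ * (Q * Ξ * Q)).trace := by
    have hcomm := trace_mul_mul_comm hQt hΞt hΔt
    have hcycle : (Ξ * Q * Δ).trace = (Δ * Ξ * Q).trace := trace_mul_cycle _ _ _
    rw [eq_sub_of_add_eq' (sub_eq_iff_eq_add.1 hQ.symm).symm, trace_mul_comm Δ Ξ,
      trace_mul_comm Δ (Q * Ξ * Q)]
    simp only [mul_sub, mul_one, add_mul, sub_mul, one_mul, trace_add, trace_sub]
    linear_combination hcomm - hcycle
  rw [← hΔ, mul_add, trace_add, mul_smul_comm, mul_smul_comm, smul_mul_assoc, mul_smul_comm,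
    trace_smul, trace_smul, trace_mul_comm Δ (signKernel S₀)] at hsub
  rw [sub_mul, smul_mul_assoc, smul_mul_assoc, hsign, hΔt, sub_mul, smul_mul_assoc, smul_mul_assoc,
    trace_sub, trace_smul, trace_smul, hsupport]
  simp only [smul_eq_mul] at hsub ⊢
  linarith

theorem trace_noise_mul_mul_transpose_le {S : SymKernel V} {K Ξ Q : Matrix V V ℝ} (hK : 0 ≤ K)
    (hKS : supportProj S * K = K) (hΞt : Ξᵀ = Ξ) (hQ : Q = 1 - supportProj S) :
    (((2 : ℝ) • ((1 + Q) * Ξ) - ε • signKernel S) * K *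
        ((2 : ℝ) • ((1 + Q) * Ξ) - ε • signKernel S)ᵀ).trace ≤
      32 * (Ξ * K * Ξ).trace + 2 * ε ^ 2 * K.trace := by
  have hGt : (signKernel S)ᵀ = signKernel S :=
    (conjTranspose_eq_transpose_of_trivial _).symm.trans (isHermitian_signKernel S)
  have hQt : Qᵀ = Q := by
    rw [hQ, transpose_sub, transpose_one, supportProj_transpose]
  have hQQ : Q * Q = Q := by
    simp only [hQ, sub_mul, mul_sub, one_mul, mul_one, supportProj_mul_self, sub_self, sub_zero]
  have hQ1 : Q ≤ 1 := hQ ▸ sub_le_self 1 (supportProj_nonneg S)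
  have hsign : (signKernel S * K * signKernel S).trace = K.trace := by
    rw [trace_mul_cycle, signKernel_mul_self, hKS]
  have hnoise : ((1 + Q) * Ξ * K * (Ξ * (1 + Q))).trace ≤ 4 * (Ξ * K * Ξ).trace := by
    have hpos : 0 ≤ Ξ * K * Ξ := by
      simpa only [conjTranspose_eq_transpose_of_trivial, hΞt] using
        ((nonneg_iff_posSemidef.1 hK).mul_mul_conjTranspose_same Ξ).nonneg
    calc
      ((1 + Q) * Ξ * K * (Ξ * (1 + Q))).trace = ((1 + Q) * (Ξ * K * Ξ) * (1 + Q)).trace := by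
        simp only [mul_assoc]
      _ = (Ξ * K * Ξ * (1 + (3 : ℝ) • Q)).trace := by
        rw [trace_mul_cycle, trace_mul_comm]
        congr 2
        simp only [add_mul, mul_add, hQQ, one_mul, mul_one]
        module
      _ ≤ (Ξ * K * Ξ * ((4 : ℝ) • 1)).trace := trace_mul_le_trace_mul_right hpos <| by
        rw [show (4 : ℝ) • (1 : Matrix V V ℝ) = 1 + (3 : ℝ) • 1 by module]
        gcongr
      _ = 4 * (Ξ * K * Ξ).trace := by rw [mul_smul_comm, mul_one, trace_smul, smul_eq_mul]
  refine (trace_sub_mul_mul_sub_transpose_le hK _ _).trans ?_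
  simp only [transpose_smul, transpose_mul, transpose_add, transpose_one, hQt, hΞt, hGt,
    smul_mul_assoc, mul_smul_comm, trace_smul, smul_eq_mul, hsign]
  linarith

theorem l2NormSq_sub_le_of_isMinOn [Nonempty V] (hW : 0 ≤ W) (hε : 0 ≤ ε) (hε' : 0 ≤ ε')
    {D : Set (SymKernel V)} (hD : Convex ℝ D) {S₀ S₁ : SymKernel V} (h₀ : S₀ ∈ D) (h₁ : S₁ ∈ D)
    (hmin : IsMinOn (penalizedRisk W ε ε' x x' y) D S₁)
    (hnoise : ‖(1 - supportProj S₀) * noiseKernel S₀ x x' y * (1 - supportProj S₀)‖ ≤ ε / 2) :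
    l2NormSq ((S₁ : Matrix V V ℝ) - (S₀ : Matrix V V ℝ)) ≤
      ε' * l2NormSq (sqrtMatrix W * (S₀ : Matrix V V ℝ)) +
        (Fintype.card V : ℝ) ^ 2 *
          (8 * (noiseKernel S₀ x x' y * supportResolvent W ε' S₀ * noiseKernel S₀ x x' y).trace +
            ε ^ 2 / 2 * (supportResolvent W ε' S₀).trace) := by
  have hB : (1 + ε' • W).PosDef := PosDef.one.add_posSemidef (hW.posSemidef.smul hε')
  set Δ := (S₁ : Matrix V V ℝ) - S₀ with hΔ
  set P := supportProj S₀ with hP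
  set K := supportResolvent W ε' S₀ with hK
  set Ξ := noiseKernel S₀ x x' y
  set H := (2 : ℝ) • ((1 + (1 - P)) * Ξ) - ε • signKernel S₀
  have hΞt : Ξᵀ = Ξ := noiseKernel_transpose S₀ x x' y
  have hbasic := basic_inequality_of_isMinOn hW hε hε' hD h₀ h₁ hmin hΔ
  have htrace : 2 * (Δ * Ξ).trace - ε * (nuclearNorm S₁ - nuclearNorm S₀) ≤ (H * P * Δᵀ).trace :=
    trace_noise_le hε hΔ hΞt hP rfl hnoise
  have hyoung := two_mul_trace_mul_transpose_le hB
    (show 0 < 2 / (Fintype.card V : ℝ) ^ 2 by positivity) Δ (H * P)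
  have hcompress : H * P * (1 + ε' • W)⁻¹ * (H * P)ᵀ = H * K * Hᵀ := by
    simp only [hK, supportResolvent, transpose_mul, hP, supportProj_transpose, mul_assoc]
  have hHK : (H * K * Hᵀ).trace ≤ 32 * (Ξ * K * Ξ).trace + 2 * ε ^ 2 * K.trace :=
    trace_noise_mul_mul_transpose_le (supportResolvent_nonneg hW hε' S₀)
      (supportProj_mul_supportResolvent W ε' S₀) hΞt rfl
  have hscaled := mul_le_mul_of_nonneg_left hHK (sq_nonneg (Fintype.card V : ℝ))
  have htrΔ : l2NormSq Δ = (Δ * Δᵀ).trace / (Fintype.card V : ℝ) ^ 2 := by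
    rw [l2NormSq_eq_trace, trace_mul_comm]
  rw [hcompress, inv_div] at hyoung
  rw [htrΔ]
  linear_combination hbasic + htrace + hyoung / 2 + hscaled / 4

end OracleInequality

section SamplingLaw

open MeasureTheory ProbabilityTheory
open scoped MatrixOrder Matrix.Norms.L2Operator

theorem integral_smul_comp_eq_sum {Ω α E : Type*} [MeasurableSpace Ω] {μ : Measure Ω} [Fintype α]
    [MeasurableSpace α] [MeasurableSingletonClass α] [NormedAddCommGroup E] [NormedSpace ℝ E]
    [CompleteSpace E] {g : Ω → ℝ} (hg : Integrable g μ) {T : Ω → α} (hT : Measurable T)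
    (f : α → E) :
    ∫ ω, g ω • f (T ω) ∂μ = ∑ a, (∫ ω in T ⁻¹' {a}, g ω ∂μ) • f a := by
  have hfib (a : α) : MeasurableSet (T ⁻¹' {a}) := hT (measurableSet_singleton a)
  have heq (a : α) : Set.EqOn (fun ω => g ω • f (T ω)) (fun ω => g ω • f a) (T ⁻¹' {a}) :=
    fun ω hω => by simp only [show T ω = a from hω]
  have hunion : ⋃ a, T ⁻¹' {a} = Set.univ := by
    rw [← Set.preimage_iUnion, Set.iUnion_of_singleton, Set.preimage_univ]
  rw [← setIntegral_univ, ← hunion, integral_iUnion_fintype hfib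
    (fun a b hab => Disjoint.preimage T (Set.disjoint_singleton.2 hab))
    fun a => (integrableOn_congr_fun (heq a) (hfib a)).2 (hg.smul_const _).integrableOn]
  exact Finset.sum_congr rfl fun a _ =>
    (setIntegral_congr_fun (hfib a) (heq a)).trans (integral_smul_const _ _)

namespace IsSimilarityTriple

variable {V Ω E : Type*} [Fintype V] [MeasurableSpace V] [MeasurableSpace Ω] {μ : Measure Ω}
  {S : SymKernel V} {X X' : Ω → V} {Y : Ω → ℝ}

theorem measurable_pair (h : IsSimilarityTriple μ S X X' Y) :
    Measurable fun ω => (X ω, X' ω) :=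
  h.measurable_left.prodMk h.measurable_right

theorem abs_label_le_one (h : IsSimilarityTriple μ S X X' Y) (ω : Ω) : |Y ω| ≤ 1 := by
  rcases h.label ω with hY | hY <;> simp only [hY, abs_neg, abs_one, le_refl]

variable [MeasurableSingletonClass V]

theorem measureReal_pair (h : IsSimilarityTriple μ S X X' Y) (p : V × V) :
    μ.real ((fun ω => (X ω, X' ω)) ⁻¹' {p}) = ((Fintype.card V : ℝ) ^ 2)⁻¹ := by
  have hleft : μ (X ⁻¹' {p.1}) = (Fintype.card V : ENNReal)⁻¹ := by
    rw [← Measure.map_apply h.measurable_left (measurableSet_singleton _), h.uniform_left,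
      uniformOn_univ, Measure.count_singleton, one_div]
  have hright : μ (X' ⁻¹' {p.2}) = (Fintype.card V : ENNReal)⁻¹ := by
    rw [← Measure.map_apply h.measurable_right (measurableSet_singleton _), h.uniform_right,
      uniformOn_univ, Measure.count_singleton, one_div]
  rw [← Prod.mk.eta (p := p), ← Set.singleton_prod_singleton, Set.mk_preimage_prod, Measure.real,
    h.indep.measure_inter_preimage_eq_mul _ _ (measurableSet_singleton _)
    (measurableSet_singleton _), hleft, hright, ENNReal.toReal_mul, ENNReal.toReal_inv,
    ENNReal.toReal_natCast, sq, mul_inv]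

theorem setIntegral_label (h : IsSimilarityTriple μ S X X' Y) (p : V × V) :
    ∫ ω in (fun ω => (X ω, X' ω)) ⁻¹' {p}, Y ω ∂μ =
      ((Fintype.card V : ℝ) ^ 2)⁻¹ * (S : Matrix V V ℝ) p.1 p.2 := by
  have hfib : {ω | X ω = p.1 ∧ X' ω = p.2} = (fun ω => (X ω, X' ω)) ⁻¹' {p} := by
    ext ω
    exact (Prod.ext_iff (x := (X ω, X' ω)) (y := p)).symm
  have hcard : (Fintype.card V : ℝ) ≠ 0 :=
    Nat.cast_ne_zero.2 (@Fintype.card_ne_zero V _ ⟨p.1⟩)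
  rw [← h.regression, hfib, ProbabilityTheory.cond, integral_smul_measure, ENNReal.toReal_inv,
    ← Measure.real, h.measureReal_pair, smul_eq_mul, ← mul_assoc,
    mul_inv_cancel₀ (inv_ne_zero (pow_ne_zero 2 hcard)), one_mul]

theorem abs_apply_le_one [IsFiniteMeasure μ] (h : IsSimilarityTriple μ S X X' Y) (u v : V) :
    |(S : Matrix V V ℝ) u v| ≤ 1 := by
  have hcard : 0 < ((Fintype.card V : ℝ) ^ 2)⁻¹ :=
    inv_pos.2 (pow_pos (Nat.cast_pos.2 (@Fintype.card_pos V _ ⟨u⟩)) 2)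
  have hint := norm_setIntegral_le_of_norm_le_const (f := Y)
    (measure_lt_top μ ((fun ω => (X ω, X' ω)) ⁻¹' {(u, v)})) fun ω _ => h.abs_label_le_one ω
  rw [h.setIntegral_label, h.measureReal_pair, Real.norm_eq_abs, abs_mul, abs_of_pos hcard,
    one_mul] at hint
  exact (mul_le_iff_le_one_right hcard).1 hint

variable [NormedAddCommGroup E] [NormedSpace ℝ E] [CompleteSpace E] [IsFiniteMeasure μ]

theorem integral_comp_pair (h : IsSimilarityTriple μ S X X' Y) (f : V → V → E) :
    ∫ ω, f (X ω) (X' ω) ∂μ = ((Fintype.card V : ℝ) ^ 2)⁻¹ • ∑ u, ∑ v, f u v := by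
  have hsum := integral_smul_comp_eq_sum (integrable_const (μ := μ) (1 : ℝ)) h.measurable_pair
    (Function.uncurry f)
  simpa only [one_smul, setIntegral_const, h.measureReal_pair, smul_eq_mul, mul_one,
    ← Finset.smul_sum, Fintype.sum_prod_type, Function.uncurry_apply_pair] using hsum

theorem integral_label_smul (h : IsSimilarityTriple μ S X X' Y) (f : V → V → E) :
    ∫ ω, Y ω • f (X ω) (X' ω) ∂μ =
      ((Fintype.card V : ℝ) ^ 2)⁻¹ • ∑ u, ∑ v, (S : Matrix V V ℝ) u v • f u v := by
  have hY : Integrable Y μ := .of_bound h.measurable_label.aestronglyMeasurable 1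
    (.of_forall h.abs_label_le_one)
  have hsum := integral_smul_comp_eq_sum hY h.measurable_pair (Function.uncurry f)
  simpa only [h.setIntegral_label, mul_smul, ← Finset.smul_sum, Fintype.sum_prod_type,
    Function.uncurry_apply_pair] using hsum

end IsSimilarityTriple

theorem measurable_label_smul {V E : Type*} [Finite V] [MeasurableSpace V]
    [MeasurableSingletonClass V] [NormedAddCommGroup E] [NormedSpace ℝ E] [MeasurableSpace E]
    [BorelSpace E] [SecondCountableTopology E] (f : V → V → E) :
    Measurable fun o : V × V × ℝ => o.2.2 • f o.1 o.2.1 :=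
  measurable_snd.snd.smul <| (Measurable.of_discrete (f := Function.uncurry f)).comp
    (measurable_fst.prodMk measurable_snd.fst)

end SamplingLaw

section SymmetrizedUnits

open Matrix
open scoped MatrixOrder Matrix.Norms.L2Operator

theorem norm_le_of_trace_mul_self_le {ι : Type*} [Fintype ι] [DecidableEq ι] {A : Matrix ι ι ℝ}
    (hA : A.IsHermitian) {r : ℝ} (hr : 0 ≤ r) (htrace : (A * A).trace ≤ r ^ 2) : ‖A‖ ≤ r := by
  refine norm_le_of_sq_le hA hr ?_
  have hsq : (A ^ 2).PosSemidef := by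
    simpa only [sq, hA.eq] using posSemidef_conjTranspose_mul_self A
  rw [← Algebra.algebraMap_eq_smul_one, le_algebraMap_iff_spectrum_le (hA.isSelfAdjoint.pow 2),
    hsq.isHermitian.spectrum_real_eq_range_eigenvalues]
  rintro _ ⟨i, rfl⟩
  calc
    hsq.isHermitian.eigenvalues i ≤ ∑ j, hsq.isHermitian.eigenvalues j :=
      Finset.single_le_sum (fun j _ => hsq.eigenvalues_nonneg j) (Finset.mem_univ i)
    _ = (A ^ 2).trace := hsq.isHermitian.trace_eq_sum_eigenvalues.symm
    _ ≤ r ^ 2 := by rwa [sq]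

variable {V : Type*} [Fintype V] [DecidableEq V]

theorem symUnit_mul_self (u v : V) :
    symUnit u v * symUnit u v =
      (1 / 4 : ℝ) •
        (single u u 1 + single v v 1 + if u = v then (2 : ℝ) • single u u 1 else 0) := by
  rcases eq_or_ne u v with rfl | huv
  · simp only [symUnit, smul_mul_smul_comm, add_mul, mul_add, single_mul_single_same, mul_one,
      if_true]
    module
  · simp only [symUnit, smul_mul_smul_comm, add_mul, mul_add, single_mul_single_same,
      single_mul_single_of_ne _ _ _ _ huv, single_mul_single_of_ne _ _ _ _ huv.symm, mul_one,
      if_neg huv]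
    module

theorem sum_symUnit_mul_self :
    ∑ u : V, ∑ v : V, symUnit u v * symUnit u v =
      (((Fintype.card V : ℝ) + 1) / 2) • (1 : Matrix V V ℝ) := by
  simp only [symUnit_mul_self, ← Finset.smul_sum, Finset.sum_add_distrib, Finset.sum_const,
    Finset.card_univ, Finset.sum_ite_eq, Finset.mem_univ, if_true, sum_single_one,
    ← Nat.cast_smul_eq_nsmul ℝ]
  module

theorem trace_mul_symUnit_mul_self_le {K : Matrix V V ℝ} {ℓ : ℝ} (hℓ : 0 ≤ ℓ)
    (hK : ∀ v, K v v ≤ ℓ) (u v : V) : (K * (symUnit u v * symUnit u v)).trace ≤ ℓ := by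
  have hu := hK u
  have hv := hK v
  rw [symUnit_mul_self]
  split_ifs <;> simp only [mul_smul_comm, mul_add, mul_zero, trace_smul, trace_add, trace_zero,
    trace_mul_single, smul_eq_mul, MulOpposite.op_one, one_smul] <;> linarith

theorem norm_symUnit_le_one (u v : V) : ‖symUnit u v‖ ≤ 1 := by
  refine norm_le_of_trace_mul_self_le
    ((conjTranspose_eq_transpose_of_trivial _).trans (symUnit_transpose u v)) zero_le_one ?_
  rw [symUnit_mul_self]
  split_ifs <;> simp [trace_single_eq_same] <;> norm_num

theorem sum_smul_symUnit (S : SymKernel V) :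
    ∑ u, ∑ v, (S : Matrix V V ℝ) u v • symUnit u v = (S : Matrix V V ℝ) := by
  have hsum : ∑ u, ∑ v, (S : Matrix V V ℝ) u v • single u v (1 : ℝ) = (S : Matrix V V ℝ) := by
    conv_rhs => rw [matrix_eq_sum_single (S : Matrix V V ℝ)]
    simp only [smul_single, smul_eq_mul, mul_one]
  have hsum' : ∑ u, ∑ v, (S : Matrix V V ℝ) u v • single v u (1 : ℝ) = (S : Matrix V V ℝ) := by
    simpa only [transpose_sum, transpose_smul, transpose_single, S.transpose_eq] using
      congrArg transpose hsum
  simp only [symUnit, smul_comm _ (1 / 2 : ℝ), smul_add, ← Finset.smul_sum,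
    Finset.sum_add_distrib, hsum, hsum']
  module

end SymmetrizedUnits

section CenteredSums

open Matrix MeasureTheory ProbabilityTheory
open scoped MatrixOrder Matrix.Norms.L2Operator

variable {Ω : Type*} [MeasurableSpace Ω] {μ : Measure Ω} [IsProbabilityMeasure μ]

theorem integral_sub_sq_le_integral_sq {ι : Type*} [Fintype ι] [DecidableEq ι]
    {A : Ω → Matrix ι ι ℝ} (hA : Measurable A) {r : ℝ} (hnorm : ∀ ω, ‖A ω‖ ≤ r)
    {M : Matrix ι ι ℝ} (hM : M.IsHermitian) (hmean : ∫ ω, A ω ∂μ = M) :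
    ∫ ω, (A ω - M) ^ 2 ∂μ ≤ ∫ ω, A ω ^ 2 ∂μ := by
  have hint {f : Matrix ι ι ℝ → Matrix ι ι ℝ} (hf : Continuous f) :
      Integrable (fun ω => f (A ω)) μ := integrable_continuous_comp hA hnorm hf
  have hexpand (ω : Ω) : (A ω - M) ^ 2 = A ω ^ 2 - (A ω * M + M * A ω - M * M) := by
    noncomm_ring
  have hpos : 0 ≤ M * M := by
    simpa only [hM.eq] using (posSemidef_conjTranspose_mul_self M).nonneg
  have hA_int : Integrable A μ := hint continuous_id
  have hcross_int : Integrable (fun ω => A ω * M + M * A ω) μ :=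
    hint (f := fun B => B * M + M * B) (by fun_prop)
  have hcross : ∫ ω, (A ω * M + M * A ω - M * M) ∂μ = M * M := by
    rw [integral_sub hcross_int (integrable_const _),
      integral_add (hA_int.mul_const M) (hA_int.const_mul M),
      integral_mul_const_of_integrable hA_int, integral_const_mul_of_integrable hA_int, hmean,
      integral_const, probReal_univ, one_smul, add_sub_cancel_right]
  simp only [hexpand]
  rw [integral_sub (hint (f := fun B => B ^ 2) (by fun_prop))
    (hint (f := fun B => B * M + M * B - M * M) (by fun_prop)), hcross]
  exact sub_le_self _ hpos

theorem integral_norm_sub_sq_le_integral_norm_sq {E : Type*} [NormedAddCommGroup E]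
    [InnerProductSpace ℝ E] [FiniteDimensional ℝ E] [MeasurableSpace E] [BorelSpace E]
    {a : Ω → E} (ha : Measurable a) {r : ℝ} (hnorm : ∀ ω, ‖a ω‖ ≤ r) :
    ∫ ω, ‖a ω - ∫ ω', a ω' ∂μ‖ ^ 2 ∂μ ≤ ∫ ω, ‖a ω‖ ^ 2 ∂μ := by
  have := FiniteDimensional.proper_real E
  have hint {f : E → ℝ} (hf : Continuous f) : Integrable (fun ω => f (a ω)) μ :=
    integrable_continuous_comp ha hnorm hf
  have ha_int : Integrable a μ := .of_bound ha.aestronglyMeasurable r (.of_forall hnorm)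
  set M := ∫ ω, a ω ∂μ with hM
  have hcross : ∫ ω, inner ℝ (a ω) M ∂μ = ‖M‖ ^ 2 := by
    simp only [real_inner_comm M]
    rw [integral_inner ha_int, ← hM, real_inner_self_eq_norm_sq]
  simp only [norm_sub_sq_real]
  have hsq_int : Integrable (fun ω => ‖a ω‖ ^ 2) μ := hint (f := fun b => ‖b‖ ^ 2) (by fun_prop)
  have hinner_int : Integrable (fun ω => 2 * inner ℝ (a ω) M) μ :=
    hint (f := fun b => 2 * inner ℝ b M) (by fun_prop)
  rw [integral_add (hint (f := fun b => ‖b‖ ^ 2 - 2 * inner ℝ b M) (by fun_prop))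
    (integrable_const _),
    integral_sub hsq_int hinner_int, integral_const_mul, hcross, integral_const, probReal_univ,
    one_smul]
  linarith [sq_nonneg ‖M‖]

theorem measureReal_lt_norm_sum_sub_integral_le {J κ : Type*} [Fintype κ]
    {a : J → Ω → EuclideanSpace ℝ κ} (hindep : iIndepFun a μ) (ha : ∀ j, Measurable (a j))
    {U : ℝ} (hU : 0 ≤ U) (hnorm : ∀ j ω, ‖a j ω‖ ≤ U) {v : J → ℝ}
    (hsq : ∀ j, ∫ ω, ‖a j ω‖ ^ 2 ∂μ ≤ v j) (s : Finset J) {T : ℝ} (hT : 0 ≤ T) :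
    μ.real {ω | 4 * √(T * ∑ j ∈ s, v j) + 8 * U * T <
      ‖∑ j ∈ s, (a j ω - ∫ ω', a j ω' ∂μ)‖} ≤
      2 * (Fintype.card κ + 1) * Real.exp (-(3 * T)) := by
  have hint (j) : Integrable (a j) μ :=
    .of_bound (ha j).aestronglyMeasurable U (.of_forall (hnorm j))
  have hmean (j) : ‖∫ ω, a j ω ∂μ‖ ≤ U := by
    simpa using norm_integral_le_of_norm_le_const (μ := μ) (.of_forall (hnorm j))
  rw [show 8 * U * T = 4 * (U + U) * T by ring]
  refine measureReal_lt_norm_sum_le (z := fun j ω => a j ω - ∫ ω', a j ω' ∂μ)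
    (hindep.comp (fun j x => x - ∫ ω', a j ω' ∂μ) fun j => measurable_id.sub_const _)
    (fun j => (ha j).sub_const _) (add_nonneg hU hU)
    (fun j ω => (norm_sub_le _ _).trans (add_le_add (hnorm j ω) (hmean j))) (fun j => ?_)
    (fun j => (integral_norm_sub_sq_le_integral_norm_sq (ha j) (hnorm j)).trans (hsq j)) s hT
  rw [integral_sub (hint j) (integrable_const _), integral_const, probReal_univ, one_smul, sub_self]

end CenteredSums

section NoiseOperatorNorm

open Matrix MeasureTheory ProbabilityTheory
open scoped MatrixOrder Matrix.Norms.L2Operator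

variable {V Ω : Type*} [Fintype V] [MeasurableSpace V] [MeasurableSpace Ω] {μ : Measure Ω}
  {S : SymKernel V}

namespace IsSimilarityTriple

variable {X X' : Ω → V} {Y : Ω → ℝ}

theorem label_mul_self (h : IsSimilarityTriple μ S X X' Y) (ω : Ω) : Y ω * Y ω = 1 := by
  rcases h.label ω with hY | hY <;> simp only [hY, mul_one, neg_mul_neg]

variable [DecidableEq V]

theorem norm_label_smul_symUnit_le (h : IsSimilarityTriple μ S X X' Y) (ω : Ω) :
    ‖Y ω • symUnit (X ω) (X' ω)‖ ≤ 1 := by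
  rw [norm_smul]
  exact mul_le_one₀ (h.abs_label_le_one ω) (norm_nonneg _) (norm_symUnit_le_one _ _)

variable [MeasurableSingletonClass V] [IsFiniteMeasure μ]

theorem integral_label_smul_symUnit (h : IsSimilarityTriple μ S X X' Y) :
    ∫ ω, Y ω • symUnit (X ω) (X' ω) ∂μ =
      ((Fintype.card V : ℝ) ^ 2)⁻¹ • (S : Matrix V V ℝ) := by
  rw [h.integral_label_smul symUnit, sum_smul_symUnit]

theorem integral_label_smul_symUnit_sq (h : IsSimilarityTriple μ S X X' Y) :
    ∫ ω, (Y ω • symUnit (X ω) (X' ω)) ^ 2 ∂μ =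
      (((Fintype.card V : ℝ) + 1) / (2 * (Fintype.card V : ℝ) ^ 2)) • (1 : Matrix V V ℝ) := by
  simp only [sq (_ • _), smul_mul_smul_comm, h.label_mul_self, one_smul]
  rw [h.integral_comp_pair fun u v => symUnit u v * symUnit u v, sum_symUnit_mul_self, smul_smul]
  congr 1
  ring

theorem norm_inv_card_sq_smul_le (h : IsSimilarityTriple μ S X X' Y) :
    ‖((Fintype.card V : ℝ) ^ 2)⁻¹ • (S : Matrix V V ℝ)‖ ≤ (Fintype.card V : ℝ)⁻¹ := by
  have hS : ‖(S : Matrix V V ℝ)‖ ≤ Fintype.card V := by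
    refine norm_le_of_trace_mul_self_le S.isHermitian (Nat.cast_nonneg _) ?_
    calc
      ((S : Matrix V V ℝ) * S).trace = ∑ u, ∑ v, (S : Matrix V V ℝ) u v ^ 2 := by
        nth_rw 2 [← S.transpose_eq]
        simp only [trace, diag_apply, mul_apply, transpose_apply, sq]
      _ ≤ ∑ _u : V, ∑ _v : V, 1 := Finset.sum_le_sum fun u _ => Finset.sum_le_sum fun v _ =>
        (sq_le_one_iff_abs_le_one _).2 (h.abs_apply_le_one u v)
      _ = (Fintype.card V : ℝ) ^ 2 := by simp [sq]
  rw [norm_smul, Real.norm_of_nonneg (by positivity)]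
  calc
    ((Fintype.card V : ℝ) ^ 2)⁻¹ * ‖(S : Matrix V V ℝ)‖ ≤
        ((Fintype.card V : ℝ) ^ 2)⁻¹ * Fintype.card V := by gcongr
    _ = (Fintype.card V : ℝ)⁻¹ := by
      simpa only [sq, mul_inv, inv_inv] using mul_self_mul_inv (Fintype.card V : ℝ)⁻¹

theorem norm_label_smul_symUnit_sub_le (h : IsSimilarityTriple μ S X X' Y) (ω : Ω) :
    ‖Y ω • symUnit (X ω) (X' ω) - ((Fintype.card V : ℝ) ^ 2)⁻¹ • (S : Matrix V V ℝ)‖ ≤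
      1 + (Fintype.card V : ℝ)⁻¹ :=
  (norm_sub_le _ _).trans
    (add_le_add (h.norm_label_smul_symUnit_le ω) h.norm_inv_card_sq_smul_le)

end IsSimilarityTriple

namespace IsSimilaritySample

variable [MeasurableSingletonClass V] {n : ℕ} {X X' : Fin n → Ω → V} {Y : Fin n → Ω → ℝ}
  {E : Type*} [NormedAddCommGroup E] [NormedSpace ℝ E] [MeasurableSpace E] [BorelSpace E]
  [SecondCountableTopology E]

theorem iIndepFun_label_smul (h : IsSimilaritySample μ S X X' Y) (f : V → V → E) :
    iIndepFun (fun j ω => Y j ω • f (X j ω) (X' j ω)) μ :=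
  h.indep.comp (fun _ o => o.2.2 • f o.1 o.2.1) fun _ => measurable_label_smul f

theorem measurable_label_smul (h : IsSimilaritySample μ S X X' Y) (f : V → V → E) (j : Fin n) :
    Measurable fun ω => Y j ω • f (X j ω) (X' j ω) :=
  (_root_.measurable_label_smul f).comp ((h.triple j).measurable_left.prodMk
    ((h.triple j).measurable_right.prodMk (h.triple j).measurable_label))

end IsSimilaritySample

theorem nat_smul_noiseKernel {V : Type*} [Fintype V] [DecidableEq V] {n : ℕ} (hn : n ≠ 0)
    (S : SymKernel V) (x x' : Fin n → V) (y : Fin n → ℝ) :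
    (n : ℝ) • noiseKernel S x x' y =
      ∑ j, (y j • symUnit (x j) (x' j) - ((Fintype.card V : ℝ) ^ 2)⁻¹ • (S : Matrix V V ℝ)) := by
  rw [noiseKernel, empiricalKernel, smul_sub, smul_inv_smul₀ (Nat.cast_ne_zero.2 hn),
    Finset.sum_sub_distrib, Finset.sum_const, Finset.card_univ, Fintype.card_fin,
    Nat.cast_smul_eq_nsmul]

namespace IsSimilaritySample

variable [DecidableEq V] [MeasurableSingletonClass V] [IsProbabilityMeasure μ] {n : ℕ}
  {X X' : Fin n → Ω → V} {Y : Fin n → Ω → ℝ}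

theorem measureReal_le_norm_sum_label_smul_symUnit_sub_le [Nonempty V]
    (h : IsSimilaritySample μ S X X' Y) {θ : ℝ} (hθ : 0 ≤ θ)
    (hθU : θ * (1 + (Fintype.card V : ℝ)⁻¹) ≤ 1) (x : ℝ) :
    μ.real {ω | x ≤ ‖∑ j, (Y j ω • symUnit (X j ω) (X' j ω) -
        ((Fintype.card V : ℝ) ^ 2)⁻¹ • (S : Matrix V V ℝ))‖} ≤
      2 * Fintype.card V * Real.exp (3 / 4 * θ ^ 2 *
        (n * (((Fintype.card V : ℝ) + 1) / (2 * (Fintype.card V : ℝ) ^ 2))) - θ * x) := by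
  set M := ((Fintype.card V : ℝ) ^ 2)⁻¹ • (S : Matrix V V ℝ)
  set A : Fin n → Ω → Matrix V V ℝ := fun j ω => Y j ω • symUnit (X j ω) (X' j ω)
  have hM : M.IsHermitian := by
    rw [IsHermitian, conjTranspose_eq_transpose_of_trivial, transpose_smul, S.transpose_eq]
  have hA (j ω) : (A j ω).IsHermitian := by
    rw [IsHermitian, conjTranspose_eq_transpose_of_trivial, transpose_smul, symUnit_transpose]
  have hmeas (j) : Measurable (A j) := h.measurable_label_smul symUnit j
  have hnorm (j ω) : ‖A j ω‖ ≤ 1 := (h.triple j).norm_label_smul_symUnit_le ω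
  have hmean (j) : ∫ ω, A j ω ∂μ = M := (h.triple j).integral_label_smul_symUnit
  have hbernstein := measureReal_le_norm_sum_le (Z := fun j ω => A j ω - M)
    ((h.iIndepFun_label_smul symUnit).comp (fun _ B => B - M) fun _ => measurable_id.sub_const M)
    (fun j => (hmeas j).sub_const M) (fun j ω => (hA j ω).sub hM)
    (fun j ω => (h.triple j).norm_label_smul_symUnit_sub_le ω)
    (fun j => by
      rw [integral_sub (.of_bound (hmeas j).aestronglyMeasurable 1 (.of_forall (hnorm j)))
        (integrable_const _), hmean, integral_const, probReal_univ, one_smul, sub_self])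
    (fun j => (integral_sub_sq_le_integral_sq (hmeas j) (hnorm j) hM (hmean j)).trans
      (h.triple j).integral_label_smul_symUnit_sq.le)
    Finset.univ hθ hθU x
  rwa [Finset.sum_const, Finset.card_univ, Fintype.card_fin, nsmul_eq_mul] at hbernstein

theorem measureReal_le_norm_noiseKernel_le (h : IsSimilaritySample μ S X X' Y)
    (hcard : 2 ≤ Fintype.card V) (hn : 0 < n) {t : ℝ} (ht : 0 ≤ t) (htn : Fintype.card V * t ≤ n) :
    μ.real {ω | 2 * √(t / (n * Fintype.card V)) ≤
      ‖noiseKernel S (fun j => X j ω) (fun j => X' j ω) fun j => Y j ω‖} ≤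
      2 * Fintype.card V * Real.exp (-(13 / 12 * t)) := by
  have : Nonempty V := Fintype.card_pos_iff.1 (two_pos.trans_le hcard)
  have hm : (2 : ℝ) ≤ Fintype.card V := mod_cast hcard
  have hn' : (0 : ℝ) < n := Nat.cast_pos.2 hn
  set m := (Fintype.card V : ℝ)
  have hθ : √(m * t / n) ≤ 1 := Real.sqrt_le_one.2 ((div_le_one hn').2 htn)
  have hθU : 2 / 3 * √(m * t / n) * (1 + m⁻¹) ≤ 1 := by
    have : m⁻¹ ≤ 2⁻¹ := inv_anti₀ two_pos hm
    nlinarith [Real.sqrt_nonneg (m * t / n)]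
  have hθx : √(m * t / n) * √(t / (n * m)) = t / n := by
    rw [← Real.sqrt_mul (by positivity), ← Real.sqrt_sq (show 0 ≤ t / n by positivity)]
    congr 1
    field_simp
  have hexponent : 3 / 4 * (2 / 3 * √(m * t / n)) ^ 2 * (n * ((m + 1) / (2 * m ^ 2))) -
      2 / 3 * √(m * t / n) * (n * (2 * √(t / (n * m)))) ≤ -(13 / 12 * t) := by
    calc
      _ = t * (m + 1) / (6 * m) - 4 / 3 * t := by
        rw [mul_pow, Real.sq_sqrt (by positivity), show 2 / 3 * √(m * t / n) *
          (n * (2 * √(t / (n * m)))) = 4 / 3 * n * (√(m * t / n) * √(t / (n * m))) by ring, hθx]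
        field_simp
        ring
      _ ≤ t / 4 - 4 / 3 * t := by
        gcongr ?_ - _
        rw [div_le_div_iff₀ (by positivity) four_pos]
        nlinarith
      _ = -(13 / 12 * t) := by ring
  calc
    _ = μ.real {ω | n * (2 * √(t / (n * m))) ≤ ‖∑ j, (Y j ω • symUnit (X j ω) (X' j ω) -
        (m ^ 2)⁻¹ • (S : Matrix V V ℝ))‖} := by
      congr! 3 with ω
      rw [← nat_smul_noiseKernel hn.ne', norm_smul, Real.norm_natCast, mul_le_mul_iff_right₀ hn']
    _ ≤ _ := h.measureReal_le_norm_sum_label_smul_symUnit_sub_le (by positivity) hθU _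
    _ ≤ _ := by gcongr

end IsSimilaritySample

end NoiseOperatorNorm

section NoiseSupport

open Matrix MeasureTheory
open scoped MatrixOrder

variable {V : Type*} [Fintype V]

/-- The entries of a matrix as a Euclidean vector, so that its norm is the Frobenius norm; it
makes the vector Bernstein inequality applicable to matrices. -/
def frobeniusVector : Matrix V V ℝ →ₗ[ℝ] EuclideanSpace ℝ (V × V) where
  toFun A := WithLp.toLp 2 (Function.uncurry A)
  map_add' _ _ := rfl
  map_smul' _ _ := rfl

theorem norm_sq_frobeniusVector (A : Matrix V V ℝ) :
    ‖frobeniusVector A‖ ^ 2 = (A * Aᵀ).trace := by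
  rw [EuclideanSpace.norm_sq_eq, Fintype.sum_prod_type]
  simp only [Real.norm_eq_abs, sq_abs, trace, diag_apply, mul_apply, transpose_apply]
  exact Finset.sum_congr rfl fun u _ => Finset.sum_congr rfl fun v _ => sq (A u v)

theorem norm_sq_frobeniusVector_mul {H : Matrix V V ℝ} (hH : Hᵀ = H) (G : Matrix V V ℝ) :
    ‖frobeniusVector (H * G)‖ ^ 2 = (G * Gᵀ * (H * H)).trace := by
  rw [norm_sq_frobeniusVector, transpose_mul, hH, ← Matrix.mul_assoc (G * Gᵀ), trace_mul_comm _ H]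
  simp only [Matrix.mul_assoc]

variable [DecidableEq V] [MeasurableSpace V] {Ω : Type*} [MeasurableSpace Ω] {μ : Measure Ω}
  {S : SymKernel V}

namespace IsSimilarityTriple

variable {X X' : Ω → V} {Y : Ω → ℝ}

theorem norm_label_smul_frobeniusVector_le (h : IsSimilarityTriple μ S X X' Y)
    {G : Matrix V V ℝ} {ℓ : ℝ} (hℓ : 0 ≤ ℓ) (hG : ∀ v, (G * Gᵀ) v v ≤ ℓ) (ω : Ω) :
    ‖Y ω • frobeniusVector (symUnit (X ω) (X' ω) * G)‖ ≤ √ℓ := by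
  have hnorm : ‖frobeniusVector (symUnit (X ω) (X' ω) * G)‖ ≤ √ℓ := by
    apply Real.le_sqrt_of_sq_le
    rw [norm_sq_frobeniusVector_mul (symUnit_transpose _ _)]
    exact trace_mul_symUnit_mul_self_le hℓ hG _ _
  rw [norm_smul]
  exact (mul_le_of_le_one_left (norm_nonneg _) (h.abs_label_le_one ω)).trans hnorm

variable [MeasurableSingletonClass V] [IsFiniteMeasure μ]

theorem integral_label_smul_frobeniusVector (h : IsSimilarityTriple μ S X X' Y)
    (G : Matrix V V ℝ) :
    ∫ ω, Y ω • frobeniusVector (symUnit (X ω) (X' ω) * G) ∂μ =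
      frobeniusVector (((Fintype.card V : ℝ) ^ 2)⁻¹ • (S : Matrix V V ℝ) * G) := by
  rw [h.integral_label_smul fun u v => frobeniusVector (symUnit u v * G)]
  simp only [← map_smul, ← map_sum, ← smul_mul_assoc, ← Finset.sum_mul, sum_smul_symUnit]

theorem integral_norm_label_smul_frobeniusVector_sq_le (h : IsSimilarityTriple μ S X X' Y)
    (G : Matrix V V ℝ) :
    ∫ ω, ‖Y ω • frobeniusVector (symUnit (X ω) (X' ω) * G)‖ ^ 2 ∂μ ≤
      (G * Gᵀ).trace / Fintype.card V := by
  have htrace : 0 ≤ (G * Gᵀ).trace := by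
    rw [← norm_sq_frobeniusVector]
    positivity
  have hsq (ω : Ω) : ‖Y ω • frobeniusVector (symUnit (X ω) (X' ω) * G)‖ ^ 2 =
      (G * Gᵀ * (symUnit (X ω) (X' ω) * symUnit (X ω) (X' ω))).trace := by
    rw [norm_smul, mul_pow, Real.norm_eq_abs, sq_abs, sq (Y ω), h.label_mul_self, one_mul,
      norm_sq_frobeniusVector_mul (symUnit_transpose _ _)]
  simp only [hsq]
  rw [h.integral_comp_pair fun u v => (G * Gᵀ * (symUnit u v * symUnit u v)).trace]
  simp only [← trace_sum, ← Finset.mul_sum, sum_symUnit_mul_self, mul_smul_comm, mul_one,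
    trace_smul, smul_eq_mul]
  rcases isEmpty_or_nonempty V with _ | _
  · simp
  · have hcard : (1 : ℝ) ≤ Fintype.card V := mod_cast Fintype.card_pos
    rw [inv_mul_le_iff₀ (by positivity), sq, mul_assoc,
      mul_div_cancel₀ _ (by positivity : (Fintype.card V : ℝ) ≠ 0)]
    gcongr
    linarith

end IsSimilarityTriple

namespace IsSimilaritySample

variable [MeasurableSingletonClass V] [IsProbabilityMeasure μ] {n : ℕ} {X X' : Fin n → Ω → V}
  {Y : Fin n → Ω → ℝ}

theorem measureReal_lt_norm_frobeniusVector_noiseKernel_mul_le (h : IsSimilaritySample μ S X X' Y)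
    (hn : 0 < n) {G : Matrix V V ℝ} {ℓ : ℝ} (hℓ : 0 ≤ ℓ) (hG : ∀ v, (G * Gᵀ) v v ≤ ℓ) {T : ℝ}
    (hT : 0 ≤ T) :
    μ.real {ω | 4 * √(T * (n * ((G * Gᵀ).trace / Fintype.card V))) + 8 * √ℓ * T < n *
      ‖frobeniusVector (noiseKernel S (fun j => X j ω) (fun j => X' j ω) (fun j => Y j ω) * G)‖} ≤
      2 * ((Fintype.card V : ℝ) ^ 2 + 1) * Real.exp (-(3 * T)) := by
  have hsum (ω : Ω) : n *
      ‖frobeniusVector (noiseKernel S (fun j => X j ω) (fun j => X' j ω) (fun j => Y j ω) * G)‖ =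
      ‖∑ j, (Y j ω • frobeniusVector (symUnit (X j ω) (X' j ω) * G) -
        ∫ ω', Y j ω' • frobeniusVector (symUnit (X j ω') (X' j ω') * G) ∂μ)‖ := by
    simp only [(h.triple _).integral_label_smul_frobeniusVector]
    simp only [← map_smul, ← map_sub, ← map_sum, ← smul_mul_assoc, ← sub_mul, ← Finset.sum_mul]
    rw [← nat_smul_noiseKernel hn.ne', smul_mul_assoc, map_smul, norm_smul, Real.norm_natCast]
  have hbernstein := measureReal_lt_norm_sum_sub_integral_le
    (h.iIndepFun_label_smul fun u v => frobeniusVector (symUnit u v * G))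
    (fun j => h.measurable_label_smul (fun u v => frobeniusVector (symUnit u v * G)) j)
    (Real.sqrt_nonneg ℓ) (fun j => (h.triple j).norm_label_smul_frobeniusVector_le hℓ hG)
    (fun j => (h.triple j).integral_norm_label_smul_frobeniusVector_sq_le G) Finset.univ hT
  simpa only [hsum, Finset.sum_const, Finset.card_univ, Fintype.card_fin, nsmul_eq_mul,
    Fintype.card_prod, ← sq, Nat.cast_pow] using hbernstein

theorem measureReal_lt_trace_noiseKernel_mul_mul_le (h : IsSimilaritySample μ S X X' Y)
    (hn : 0 < n) {K : Matrix V V ℝ} (hK : 0 ≤ K) {ℓ : ℝ} (hℓ : 0 ≤ ℓ) (hKℓ : ∀ v, K v v ≤ ℓ)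
    {T : ℝ} (hT : 0 ≤ T) :
    μ.real {ω | 32 * (T * K.trace / (n * Fintype.card V)) + 128 * ℓ * (T / n) ^ 2 <
      (noiseKernel S (fun j => X j ω) (fun j => X' j ω) (fun j => Y j ω) * K *
        noiseKernel S (fun j => X j ω) (fun j => X' j ω) (fun j => Y j ω)).trace} ≤
      2 * ((Fintype.card V : ℝ) ^ 2 + 1) * Real.exp (-(3 * T)) := by
  set m := (Fintype.card V : ℝ)
  set Ξ : Ω → Matrix V V ℝ := fun ω => noiseKernel S (fun j => X j ω) (fun j => X' j ω)
    fun j => Y j ω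
  have hG : sqrtMatrix K * (sqrtMatrix K)ᵀ = K := by
    rw [sqrtMatrix_transpose, sqrtMatrix, CFC.sqrt_mul_sqrt_self K]
  have htrace (ω : Ω) : (Ξ ω * K * Ξ ω).trace = ‖frobeniusVector (Ξ ω * sqrtMatrix K)‖ ^ 2 := by
    rw [norm_sq_frobeniusVector_mul (noiseKernel_transpose _ _ _ _), hG, trace_mul_cycle,
      trace_mul_comm]
  have htail := h.measureReal_lt_norm_frobeniusVector_noiseKernel_mul_le hn hℓ
    (G := sqrtMatrix K) (by rwa [hG]) hT
  rw [hG] at htail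
  refine (measureReal_mono fun ω hω => ?_).trans htail
  rw [Set.mem_ofPred_eq, htrace] at hω
  by_contra! hle
  rw [Set.mem_ofPred_eq, not_lt] at hle
  have hn' : (0 : ℝ) < n := Nat.cast_pos.2 hn
  have hK_trace : 0 ≤ K.trace := hK.posSemidef.trace_nonneg
  refine hω.not_ge ((mul_le_mul_iff_right₀ (pow_pos hn' 2)).1 ?_)
  calc
    _ = (n * ‖frobeniusVector (Ξ ω * sqrtMatrix K)‖) ^ 2 := (mul_pow _ _ 2).symm
    _ ≤ (4 * √(T * (n * (K.trace / m))) + 8 * √ℓ * T) ^ 2 := by gcongr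
    _ ≤ 2 * ((4 * √(T * (n * (K.trace / m)))) ^ 2 + (8 * √ℓ * T) ^ 2) := add_sq_le
    _ = n ^ 2 * (32 * (T * K.trace / (n * m)) + 128 * ℓ * (T / n) ^ 2) := by
      rw [mul_pow, mul_pow _ T, mul_pow, Real.sq_sqrt (by positivity), Real.sq_sqrt hℓ]
      field_simp
      ring

end IsSimilaritySample

end NoiseSupport

section Coherence

variable {V : Type*} [Fintype V] {L : Submodule ℝ (EuclideanSpace ℝ V)}
  {φ : ℕ → EuclideanSpace ℝ V}

theorem le_coherence {k t j : ℕ} (ht : 1 ≤ t) (htk : t ≤ k) (htj : t ≤ j)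
    (hj : j ≤ Fintype.card V) :
    (t : ℝ) * ((1 / (j : ℝ)) * ∑ i ∈ Finset.Icc 1 j, ‖L.starProjection (φ i)‖ ^ 2) ≤
      coherence L φ k := by
  have hinner : (1 / (j : ℝ)) * ∑ i ∈ Finset.Icc 1 j, ‖L.starProjection (φ i)‖ ^ 2 ≤
      sSup ((fun j : ℕ => (1 / (j : ℝ)) * ∑ i ∈ Finset.Icc 1 j, ‖L.starProjection (φ i)‖ ^ 2) ''
        Set.Icc t (Fintype.card V)) :=
    le_csSup ((Set.finite_Icc _ _).image _).bddAbove ⟨j, ⟨htj, hj⟩, rfl⟩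
  exact (mul_le_mul_of_nonneg_left hinner (Nat.cast_nonneg t)).trans <|
    le_csSup ((Set.finite_Icc _ _).image _).bddAbove ⟨t, ⟨ht, le_min htk (htj.trans hj)⟩, rfl⟩

theorem sum_norm_starProjection_sq_le_coherence_div_mul {s j : ℕ} (hs : 1 ≤ s) (hsj : s ≤ j)
    (hj : j ≤ Fintype.card V) :
    ∑ i ∈ Finset.Icc 1 j, ‖L.starProjection (φ i)‖ ^ 2 ≤ coherence L φ s / s * j := by
  have hs' : (0 : ℝ) < s := Nat.cast_pos.2 hs
  have hj' : (0 : ℝ) < j := Nat.cast_pos.2 (hs.trans hsj)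
  have hle := le_coherence (L := L) (φ := φ) hs le_rfl hsj hj
  rw [one_div, ← mul_assoc, ← div_eq_mul_inv] at hle
  rwa [div_mul_eq_mul_div, le_div_iff₀ hs', ← div_le_iff₀ hj', mul_comm, mul_div_right_comm]

theorem sum_norm_starProjection_sq_le_coherence {s : ℕ} (hcard : 1 ≤ Fintype.card V)
    (hs : Fintype.card V ≤ s) :
    ∑ i ∈ Finset.Icc 1 (Fintype.card V), ‖L.starProjection (φ i)‖ ^ 2 ≤ coherence L φ s := by
  have hle := le_coherence (L := L) (φ := φ) hcard hs le_rfl le_rfl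
  rwa [← mul_assoc, mul_one_div_cancel (Nat.cast_ne_zero.2 (Nat.one_le_iff_ne_zero.1 hcard)),
    one_mul] at hle

theorem sum_mul_le_sum_mul_add {a g : ℕ → ℝ} {b : ℝ} {s m : ℕ}
    (ha : ∀ j, s ≤ j → j ≤ m → ∑ i ∈ Finset.Icc 1 j, a i ≤ b * j)
    (hg_one : ∀ k, 1 ≤ k → k ≤ s → g k = 1) (hg : ∀ k, s ≤ k → k + 1 ≤ m → g (k + 1) ≤ g k)
    (hs : 1 ≤ s) {M : ℕ} (hsM : s ≤ M) (hMm : M ≤ m) :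
    ∑ i ∈ Finset.Icc 1 M, a i * g i ≤
      (∑ i ∈ Finset.Icc 1 M, a i) * g M + b * (s + ∑ k ∈ Finset.Icc (s + 1) M, g k - M * g M) := by
  induction M, hsM using Nat.le_induction with
  | base =>
    rw [Finset.Icc_eq_empty_of_lt (Nat.lt_succ_self s), hg_one s hs le_rfl, Finset.sum_empty]
    refine le_of_eq ?_
    simp only [mul_one, add_zero, sub_self, mul_zero]
    exact Finset.sum_congr rfl fun i hi => by
      rw [hg_one i (Finset.mem_Icc.1 hi).1 (Finset.mem_Icc.1 hi).2, mul_one]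
  | succ M hM ih =>
    have hstep := mul_le_mul_of_nonneg_right (ha M hM (Nat.le_of_succ_le hMm))
      (sub_nonneg.2 (hg M hM hMm))
    have ih := ih (Nat.le_of_succ_le hMm)
    rw [Finset.sum_Icc_succ_top (by omega), Finset.sum_Icc_succ_top (by omega),
      Finset.sum_Icc_succ_top (by omega)]
    push_cast
    linear_combination ih + hstep

theorem sum_mul_le_mul_add_sum {a g : ℕ → ℝ} {b : ℝ} {s m : ℕ}
    (ha : ∀ j, s ≤ j → j ≤ m → ∑ i ∈ Finset.Icc 1 j, a i ≤ b * j)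
    (hg_one : ∀ k, 1 ≤ k → k ≤ s → g k = 1) (hg : ∀ k, s ≤ k → k + 1 ≤ m → g (k + 1) ≤ g k)
    (hs : 1 ≤ s) (hsm : s ≤ m) (hgm : 0 ≤ g m) :
    ∑ i ∈ Finset.Icc 1 m, a i * g i ≤ b * (s + ∑ k ∈ Finset.Icc (s + 1) m, g k) := by
  linear_combination sum_mul_le_sum_mul_add ha hg_one hg hs hsm le_rfl +
    mul_le_mul_of_nonneg_right (ha m hsm le_rfl) hgm

theorem inv_one_add_mul_le_div_max {x y r : ℝ} (hx : 0 < x) (hy : 0 ≤ y) (hr : x⁻¹ ≤ r) :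
    (1 + r * y)⁻¹ ≤ x / max x y := by
  have hxr : 1 ≤ x * r := by rwa [← div_le_iff₀' hx, one_div]
  have hr0 : 0 ≤ r := (inv_nonneg.2 hx.le).trans hr
  rw [inv_le_comm₀ (by positivity) (by positivity), inv_div, div_le_iff₀ hx]
  refine max_le ?_ ?_ <;> nlinarith [mul_nonneg hr0 hy]

namespace IsSpectralRepresentation

variable {W : Matrix V V ℝ} {lam : ℕ → ℝ} {s : ℕ} {c ε' : ℝ}

theorem sum_div_max_le (h : IsSpectralRepresentation W lam φ) (hs : 1 ≤ s)
    (hsm : s ≤ Fintype.card V) (hpos : 0 < lam s)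
    (htail : ∑ k ∈ Finset.Icc s (Fintype.card V), 1 / lam k ≤ c * (s / lam s)) :
    ∑ k ∈ Finset.Icc (s + 1) (Fintype.card V), lam s / max (lam s) (lam k) ≤ c * s := by
  have hle {k : ℕ} (hk : k ∈ Finset.Icc s (Fintype.card V)) : lam s ≤ lam k :=
    h.mono s (Finset.mem_Icc.2 ⟨hs, hsm⟩) k
      (Finset.mem_Icc.2 ⟨hs.trans (Finset.mem_Icc.1 hk).1, (Finset.mem_Icc.1 hk).2⟩)
      (Finset.mem_Icc.1 hk).1
  have hsub : Finset.Icc (s + 1) (Fintype.card V) ⊆ Finset.Icc s (Fintype.card V) :=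
    Finset.Icc_subset_Icc_left s.le_succ
  calc
    _ = ∑ k ∈ Finset.Icc (s + 1) (Fintype.card V), lam s * (1 / lam k) :=
      Finset.sum_congr rfl fun k hk => by rw [max_eq_right (hle (hsub hk)), mul_one_div]
    _ = lam s * ∑ k ∈ Finset.Icc (s + 1) (Fintype.card V), 1 / lam k := Finset.mul_sum .. |>.symm
    _ ≤ lam s * ∑ k ∈ Finset.Icc s (Fintype.card V), 1 / lam k := by
      exact mul_le_mul_of_nonneg_left (Finset.sum_le_sum_of_subset_of_nonneg hsub fun k hk _ =>
        one_div_nonneg.2 (hpos.le.trans (hle hk))) hpos.le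
    _ ≤ lam s * (c * (s / lam s)) := by gcongr
    _ = c * s := by field_simp

theorem sum_norm_starProjection_sq_div_le (h : IsSpectralRepresentation W lam φ) (hs : 1 ≤ s)
    (hsm : s ≤ Fintype.card V) (hpos : 0 < lam s)
    (htail : ∑ k ∈ Finset.Icc s (Fintype.card V), 1 / lam k ≤ c * (s / lam s))
    (hε' : (lam s)⁻¹ ≤ ε') :
    ∑ k ∈ Finset.Icc 1 (Fintype.card V), ‖L.starProjection (φ k)‖ ^ 2 / (1 + ε' * lam k) ≤
      (1 + c) * coherence L φ s := by
  have hs' : (0 : ℝ) < s := Nat.cast_pos.2 hs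
  have hsum {j : ℕ} (hsj : s ≤ j) (hj : j ≤ Fintype.card V) :=
    sum_norm_starProjection_sq_le_coherence_div_mul (L := L) (φ := φ) hs hsj hj
  have hcoherence : 0 ≤ coherence L φ s / s :=
    nonneg_of_mul_nonneg_left
      ((Finset.sum_nonneg fun _ _ => sq_nonneg _).trans (hsum le_rfl hsm)) hs'
  calc
    _ ≤ ∑ k ∈ Finset.Icc 1 (Fintype.card V),
        ‖L.starProjection (φ k)‖ ^ 2 * (lam s / max (lam s) (lam k)) :=
      Finset.sum_le_sum fun k hk => mul_le_mul_of_nonneg_left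
        (inv_one_add_mul_le_div_max hpos (h.nonneg k hk) hε') (sq_nonneg _)
    _ ≤ coherence L φ s / s *
        (s + ∑ k ∈ Finset.Icc (s + 1) (Fintype.card V), lam s / max (lam s) (lam k)) := by
      refine sum_mul_le_mul_add_sum (fun j => hsum) (fun k hk hks => ?_) (fun k hsk hk => ?_) hs
        hsm (by positivity)
      · rw [max_eq_left (h.mono k (Finset.mem_Icc.2 ⟨hk, hks.trans hsm⟩) s
          (Finset.mem_Icc.2 ⟨hs, hsm⟩) hks), div_self hpos.ne']
      · gcongr
        exact h.mono k (Finset.mem_Icc.2 ⟨hs.trans hsk, Nat.le_of_succ_le hk⟩) (k + 1)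
          (Finset.mem_Icc.2 ⟨k.succ_pos, hk⟩) k.le_succ
    _ ≤ coherence L φ s / s * (s + c * s) := by
      gcongr
      exact h.sum_div_max_le hs hsm hpos htail
    _ = (1 + c) * coherence L φ s := by field_simp

theorem sum_norm_starProjection_sq_div_le_sum (h : IsSpectralRepresentation W lam φ)
    (hε' : 0 ≤ ε') :
    ∑ k ∈ Finset.Icc 1 (Fintype.card V), ‖L.starProjection (φ k)‖ ^ 2 / (1 + ε' * lam k) ≤
      ∑ k ∈ Finset.Icc 1 (Fintype.card V), ‖L.starProjection (φ k)‖ ^ 2 :=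
  Finset.sum_le_sum fun k hk => div_le_self (sq_nonneg _)
    (le_add_of_nonneg_right (mul_nonneg hε' (h.nonneg k hk)))

end IsSpectralRepresentation

end Coherence

section SpectralRepresentation

open Matrix
open scoped MatrixOrder

namespace IsSpectralRepresentation

variable {V : Type*} [Fintype V] {W : Matrix V V ℝ} {lam : ℕ → ℝ} {φ : ℕ → EuclideanSpace ℝ V}

theorem invEigenvalue_nonneg (h : IsSpectralRepresentation W lam φ) {s : ℕ} (hs : 1 ≤ s) :
    0 ≤ invEigenvalue (Fintype.card V) lam s := by
  rw [invEigenvalue]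
  split_ifs with hsm
  · exact inv_nonneg.2 (h.nonneg s (Finset.mem_Icc.2 ⟨hs, hsm⟩))
  · rfl

theorem dotProduct_eq_ite (h : IsSpectralRepresentation W lam φ)
    (j k : Finset.Icc 1 (Fintype.card V)) : φ j ⬝ᵥ φ k = if j = k then 1 else 0 := by
  simpa only [EuclideanSpace.inner_eq_star_dotProduct, star_trivial, eq_comm] using
    orthonormal_iff_ite.1 h.orthonormal k j

theorem matrix_nonneg (h : IsSpectralRepresentation W lam φ) : 0 ≤ W := by
  rw [h.eq_sum]
  refine Finset.sum_nonneg fun k hk => smul_nonneg (h.nonneg k hk) ?_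
  simpa only [star_trivial] using (posSemidef_vecMulVec_self_star (φ k).ofLp).nonneg

theorem mulVec_eq (h : IsSpectralRepresentation W lam φ) (k : Finset.Icc 1 (Fintype.card V)) :
    W *ᵥ φ k = lam k • (φ k).ofLp := by
  conv_lhs => rw [h.eq_sum, ← Finset.sum_coe_sort]
  simp only [sum_mulVec, smul_mulVec, vecMulVec_mulVec, h.dotProduct_eq_ite]
  simp

theorem trace_eq (h : IsSpectralRepresentation W lam φ) (M : Matrix V V ℝ) :
    M.trace = ∑ k ∈ Finset.Icc 1 (Fintype.card V), φ k ⬝ᵥ M *ᵥ φ k := by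
  classical
  set Φ : Matrix V (Finset.Icc 1 (Fintype.card V)) ℝ := of fun v k => φ k v
  have hΦ : Φᵀ * Φ = 1 := by
    ext j k
    rw [mul_apply', one_apply]
    exact h.dotProduct_eq_ite j k
  have hΦ' : Φ * Φᵀ = 1 := (mul_eq_one_comm_of_card_eq _ _ _ (by simp)).1 hΦ
  calc
    M.trace = (Φᵀ * (M * Φ)).trace := by
      rw [trace_mul_comm, Matrix.mul_assoc, hΦ', Matrix.mul_one]
    _ = ∑ k : Finset.Icc 1 (Fintype.card V), φ k ⬝ᵥ M *ᵥ φ k :=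
      Finset.sum_congr rfl fun k _ => mul_apply' ..
    _ = ∑ k ∈ Finset.Icc 1 (Fintype.card V), φ k ⬝ᵥ M *ᵥ φ k :=
      Finset.sum_coe_sort _ fun k => φ k ⬝ᵥ M *ᵥ φ k

variable [DecidableEq V]

theorem resolvent_mulVec (h : IsSpectralRepresentation W lam φ) {ε' : ℝ} (hε' : 0 ≤ ε')
    (k : Finset.Icc 1 (Fintype.card V)) :
    (1 + ε' • W)⁻¹ *ᵥ φ k = (1 + ε' * lam k)⁻¹ • (φ k).ofLp := by
  have hpos : 0 < 1 + ε' * lam k :=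
    add_pos_of_pos_of_nonneg one_pos (mul_nonneg hε' (h.nonneg k k.2))
  have hunit : IsUnit (1 + ε' • W).det := (isUnit_iff_isUnit_det _).1
    (PosDef.one.add_posSemidef (h.matrix_nonneg.posSemidef.smul hε')).isUnit
  have heigen : (1 + ε' • W) *ᵥ φ k = (1 + ε' * lam k) • (φ k).ofLp := by
    rw [add_mulVec, one_mulVec, smul_mulVec, h.mulVec_eq, smul_smul, add_smul, one_smul]
  rw [eq_inv_smul_iff₀ hpos.ne', ← mulVec_smul, ← heigen, mulVec_mulVec,
    nonsing_inv_mul _ hunit, one_mulVec]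

theorem trace_supportResolvent (h : IsSpectralRepresentation W lam φ) {ε' : ℝ} (hε' : 0 ≤ ε')
    (S : SymKernel V) : (supportResolvent W ε' S).trace =
      ∑ k ∈ Finset.Icc 1 (Fintype.card V),
        ‖(kernelSupport S).starProjection (φ k)‖ ^ 2 / (1 + ε' * lam k) := by
  rw [supportResolvent, trace_mul_cycle, supportProj_mul_self, h.trace_eq]
  refine Finset.sum_congr rfl fun k hk => ?_
  rw [← mulVec_mulVec, h.resolvent_mulVec hε' ⟨k, hk⟩, mulVec_smul, dotProduct_smul,
    norm_sq_kernelSupport_starProjection, smul_eq_mul, inv_mul_eq_div]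

theorem trace_supportResolvent_le_coherence [Nonempty V] (h : IsSpectralRepresentation W lam φ)
    {c : ℝ} (hc : 0 ≤ c) {s : ℕ} (hs : 1 ≤ s)
    (hreg : s ≤ Fintype.card V → 0 < lam s ∧
      ∑ k ∈ Finset.Icc s (Fintype.card V), 1 / lam k ≤ c * (s / lam s))
    {ε' : ℝ} (hε' : invEigenvalue (Fintype.card V) lam s ≤ ε') (S : SymKernel V) :
    (supportResolvent W ε' S).trace ≤ (1 + c) * coherence (kernelSupport S) φ s := by
  have hε'_nonneg := (h.invEigenvalue_nonneg hs).trans hε'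
  rw [h.trace_supportResolvent hε'_nonneg]
  rcases le_or_gt s (Fintype.card V) with hsm | hsm
  · obtain ⟨hpos, htail⟩ := hreg hsm
    rw [invEigenvalue, if_pos hsm] at hε'
    exact h.sum_norm_starProjection_sq_div_le hs hsm hpos htail hε'
  · have hsum := sum_norm_starProjection_sq_le_coherence (L := kernelSupport S) (φ := φ)
      Fintype.card_pos hsm.le
    exact (h.sum_norm_starProjection_sq_div_le_sum hε'_nonneg).trans <| hsum.trans <|
      le_mul_of_one_le_left ((Finset.sum_nonneg fun _ _ => sq_nonneg _).trans hsum)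
        (le_add_of_nonneg_right hc)

end IsSpectralRepresentation

end SpectralRepresentation

section Leverage

open Matrix
open scoped MatrixOrder Matrix.Norms.L2Operator

variable {V : Type*} [Fintype V] [DecidableEq V]

theorem supportProj_apply_self_le_maxLeverage (S : SymKernel V) (v : V) :
    supportProj S v v ≤ maxLeverage (kernelSupport S) := by
  have hdiag : supportProj S v v =
      ‖(kernelSupport S).starProjection (EuclideanSpace.single v (1 : ℝ))‖ ^ 2 := by
    rw [norm_sq_kernelSupport_starProjection]
    simp [EuclideanSpace.single]
  exact hdiag.trans_le (le_ciSup (f := fun v : V =>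
    ‖(kernelSupport S).starProjection (EuclideanSpace.single v (1 : ℝ))‖ ^ 2)
    (Set.finite_range _).bddAbove v)

theorem inv_one_add_le_one {A : Matrix V V ℝ} (hA : 0 ≤ A) : (1 + A)⁻¹ ≤ 1 := by
  have hpos : (1 + A).PosDef := PosDef.one.add_posSemidef hA.posSemidef
  set R := (1 + A)⁻¹
  have hRsa : IsSelfAdjoint R := hpos.inv.isHermitian
  have hRA : R * A * R = R - R * R := by
    have hinv : R * (1 + A) = 1 := nonsing_inv_mul _ ((isUnit_iff_isUnit_det _).1 hpos.isUnit)
    rw [mul_add, mul_one, ← eq_sub_iff_add_eq'] at hinv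
    rw [hinv, sub_mul, one_mul]
  have hsq : 0 ≤ (1 - R) * (1 - R) := (IsSelfAdjoint.one _).sub hRsa |>.mul_self_nonneg
  have hconj : 0 ≤ R * A * R := hRsa.conjugate_nonneg hA
  rw [← sub_nonneg]
  calc
    0 ≤ (1 - R) * (1 - R) + R * A * R := add_nonneg hsq hconj
    _ = 1 - R := by
      rw [hRA]
      noncomm_ring

theorem supportResolvent_le_supportProj {W : Matrix V V ℝ} (hW : 0 ≤ W) {ε' : ℝ} (hε' : 0 ≤ ε')
    (S : SymKernel V) : supportResolvent W ε' S ≤ supportProj S :=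
  calc
    supportResolvent W ε' S ≤ supportProj S * 1 * supportProj S :=
      (isHermitian_supportProj S).isSelfAdjoint.conjugate_le_conjugate
        (inv_one_add_le_one (smul_nonneg hε' hW))
    _ = supportProj S := by rw [mul_one, supportProj_mul_self]

theorem supportResolvent_apply_self_le_maxLeverage {W : Matrix V V ℝ} (hW : 0 ≤ W) {ε' : ℝ}
    (hε' : 0 ≤ ε') (S : SymKernel V) (v : V) :
    supportResolvent W ε' S v v ≤ maxLeverage (kernelSupport S) :=
  (sub_nonneg.1 (le_iff.1 (supportResolvent_le_supportProj hW hε' S)).diag_nonneg).trans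
    (supportProj_apply_self_le_maxLeverage S v)

theorem maxLeverage_nonneg (L : Submodule ℝ (EuclideanSpace ℝ V)) : 0 ≤ maxLeverage L :=
  Real.iSup_nonneg fun _ => sq_nonneg _

theorem norm_one_sub_supportProj_le_one (S : SymKernel V) : ‖1 - supportProj S‖ ≤ 1 := by
  refine norm_le_of_sq_le (isHermitian_one.sub (isHermitian_supportProj S)) zero_le_one ?_
  have hsq : (1 - supportProj S) ^ 2 = 1 - supportProj S := by
    simp only [sq, sub_mul, mul_sub, one_mul, mul_one, supportProj_mul_self, sub_self, sub_zero]
  rw [hsq, one_pow, one_smul]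
  exact sub_le_self _ (supportProj_nonneg S)

theorem norm_off_support_le (S : SymKernel V) (A : Matrix V V ℝ) :
    ‖(1 - supportProj S) * A * (1 - supportProj S)‖ ≤ ‖A‖ :=
  calc
    _ ≤ ‖1 - supportProj S‖ * ‖A‖ * ‖1 - supportProj S‖ := norm_mul₃_le
    _ ≤ 1 * ‖A‖ * 1 := by
      gcongr <;> exact norm_one_sub_supportProj_le_one S
    _ = ‖A‖ := by rw [one_mul, mul_one]

theorem supportProj_eq_one_of_card_le_one {S : SymKernel V} (hS : (S : Matrix V V ℝ) ≠ 0)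
    (hV : Fintype.card V ≤ 1) : supportProj S = 1 := by
  have : Subsingleton V := Fintype.card_le_one_iff_subsingleton.1 hV
  ext u v
  obtain rfl := Subsingleton.elim u v
  have hne : (S : Matrix V V ℝ) u u ≠ 0 := fun h => hS <| by
    ext a b
    rw [Subsingleton.elim a u, Subsingleton.elim b u, h, Matrix.zero_apply]
  have happly := congrFun (congrFun (mul_supportProj S) u) u
  rw [mul_apply, Fintype.sum_subsingleton _ u] at happly
  rw [one_apply_eq]
  exact mul_left_cancel₀ hne (happly.trans (mul_one _).symm)

end Leverage

section TailBudget

variable {t T : ℝ} {m : ℕ}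

theorem two_mul_mul_exp_neg_le (ht : 0 ≤ t) (hm : 2 ≤ m) :
    2 * m * Real.exp (-(13 / 12 * (t + Real.log (2 * m)))) ≤ 9 / 10 * Real.exp (-t) := by
  have hm' : (2 : ℝ) ≤ m := mod_cast hm
  have hexp : Real.exp (-(t + Real.log (2 * m))) = Real.exp (-t) / (2 * m) := by
    rw [neg_add, Real.exp_add, Real.exp_neg (Real.log _), Real.exp_log (by linarith),
      div_eq_mul_inv]
  have hroot : Real.exp (-((t + Real.log (2 * m)) / 12)) ≤ 9 / 10 := by
    refine le_of_pow_le_pow_left₀ (n := 12) (by norm_num) (by norm_num) ?_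
    calc
      Real.exp (-((t + Real.log (2 * m)) / 12)) ^ 12 = Real.exp (-t) / (2 * m) := by
        rw [← hexp, ← Real.exp_nat_mul]
        congr 1
        ring
      _ ≤ 1 / (2 * 2) := by
        gcongr
        exact Real.exp_le_one_iff.2 (neg_nonpos.2 ht)
      _ ≤ (9 / 10) ^ 12 := by norm_num
  calc
    2 * m * Real.exp (-(13 / 12 * (t + Real.log (2 * m)))) =
        Real.exp (-((t + Real.log (2 * m)) / 12)) * Real.exp (-t) := by
      rw [show -(13 / 12 * (t + Real.log (2 * m))) =
        -((t + Real.log (2 * m)) / 12) + -(t + Real.log (2 * m)) by ring, Real.exp_add, hexp]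
      field_simp
    _ ≤ 9 / 10 * Real.exp (-t) := by gcongr

theorem two_mul_sq_add_one_mul_exp_neg_le (ht : 0 ≤ t) (hm : 1 ≤ m)
    (hT : t + Real.log (8 * m) ≤ T) :
    2 * ((m : ℝ) ^ 2 + 1) * Real.exp (-(3 * T)) ≤ 1 / 10 * Real.exp (-t) := by
  have hm' : (1 : ℝ) ≤ m := mod_cast hm
  have hexp : Real.exp (-T) ≤ Real.exp (-t) / (8 * m) := by
    rw [div_eq_mul_inv, ← Real.exp_log (show (0 : ℝ) < 8 * m by linarith), ← Real.exp_neg,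
      ← Real.exp_add]
    gcongr
    linarith
  have ht' : Real.exp (-t) ≤ 1 := Real.exp_le_one_iff.2 (neg_nonpos.2 ht)
  calc
    2 * ((m : ℝ) ^ 2 + 1) * Real.exp (-(3 * T)) ≤
        2 * ((m : ℝ) ^ 2 + m ^ 2) * (Real.exp (-t) / (8 * m)) ^ 3 := by
      rw [show -(3 * T) = (3 : ℕ) * -T by push_cast; ring, Real.exp_nat_mul]
      gcongr
      exact one_le_pow₀ hm'
    _ = Real.exp (-t) ^ 2 / (128 * m) * Real.exp (-t) := by
      field_simp
      norm_num
    _ ≤ 1 ^ 2 / (10 * 1) * Real.exp (-t) := by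
      gcongr
      norm_num
    _ = 1 / 10 * Real.exp (-t) := by norm_num

theorem pos_of_mul_tnm_le {ζ : ℝ} {n : ℕ} (ht : 0 < t) (hζ : 1 ≤ ζ) (hm : 1 ≤ m)
    (h : m * tnm t ζ n m ≤ n) : 0 < n := by
  refine Nat.pos_of_ne_zero ?_
  rintro rfl
  have hm' : (1 : ℝ) ≤ m := mod_cast hm
  have htnm : 0 < tnm t ζ 0 m := by
    rw [tnm, Nat.cast_zero, Real.zero_rpow (by linarith), mul_zero, zero_mul, Real.logb_zero,
      zero_add]
    exact add_pos_of_pos_of_nonneg ht (Real.log_nonneg (by linarith))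
  exact h.not_gt (Nat.cast_zero (R := ℝ) ▸ mul_pos (by linarith) htnm)

theorem le_tnm {ζ : ℝ} {n : ℕ} (t : ℝ) (hζ : 0 ≤ ζ) (hm : 1 ≤ m) (hn : 0 < n) :
    t + Real.log (8 * m) ≤ tnm t ζ n m := by
  have hm' : (1 : ℝ) ≤ m := mod_cast hm
  have hn' : (1 : ℝ) ≤ n := mod_cast hn
  have hbase : (2 : ℝ) ^ (2 : ℝ) ≤ 4 * (n : ℝ) ^ ζ * (m : ℝ) ^ (3 / 2 * ζ) :=
    calc
      (2 : ℝ) ^ (2 : ℝ) = 4 * 1 * 1 := by norm_num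
      _ ≤ 4 * (n : ℝ) ^ ζ * (m : ℝ) ^ (3 / 2 * ζ) := by
        gcongr
        · exact Real.one_le_rpow hn' hζ
        · exact Real.one_le_rpow hm' (by positivity)
  have hlogb := (Real.le_logb_iff_rpow_le one_lt_two (by positivity)).2 hbase
  rw [tnm]
  gcongr _ + Real.log ?_
  linarith [mul_le_mul_of_nonneg_left hlogb (show (0 : ℝ) ≤ 2 * m by positivity)]

end TailBudget

section ErrorBound

open Matrix MeasureTheory
open scoped MatrixOrder Matrix.Norms.L2Operator

variable {V : Type*} [Fintype V] [DecidableEq V]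

theorem nuclearPenalty_sq {t : ℝ} {n m : ℕ} (h : 0 ≤ t + Real.log (2 * m)) :
    nuclearPenalty t n m ^ 2 = 16 * ((t + Real.log (2 * m)) / (n * m)) := by
  rw [nuclearPenalty, mul_pow, Real.sq_sqrt (by positivity)]
  norm_num

theorem nuclearPenalty_nonneg (t : ℝ) (n m : ℕ) : 0 ≤ nuclearPenalty t n m := by
  rw [nuclearPenalty]
  positivity

theorem log_two_mul_nonneg {m : ℕ} (hm : 1 ≤ m) : 0 ≤ Real.log (2 * m) :=
  Real.log_nonneg (one_le_mul_of_one_le_of_one_le one_le_two (mod_cast hm))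

theorem add_log_two_mul_le {m : ℕ} (hm : 1 ≤ m) {t T : ℝ} (hT : t + Real.log (8 * m) ≤ T) :
    t + Real.log (2 * m) ≤ T := by
  have : (0 : ℝ) < m := Nat.cast_pos.2 hm
  refine le_trans ?_ hT
  gcongr
  norm_num

theorem l2NormSq_sub_le_of_isMinOn_of_trace_le [Nonempty V] {W : Matrix V V ℝ} (hW : 0 ≤ W)
    {ε' : ℝ} (hε' : 0 ≤ ε') {n : ℕ} (hn : 0 < n) {x x' : Fin n → V} {y : Fin n → ℝ}
    {D : Set (SymKernel V)} (hD : Convex ℝ D) {S₀ S₁ : SymKernel V} (h₀ : S₀ ∈ D) (h₁ : S₁ ∈ D)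
    {t T : ℝ} (ht : 0 ≤ t) (hT : t + Real.log (2 * Fintype.card V) ≤ T)
    (hmin : IsMinOn (penalizedRisk W (nuclearPenalty t n (Fintype.card V)) ε' x x' y) D S₁)
    (hnoise : ‖(1 - supportProj S₀) * noiseKernel S₀ x x' y * (1 - supportProj S₀)‖ ≤
      nuclearPenalty t n (Fintype.card V) / 2) {q ℓ : ℝ}
    (htrace : (noiseKernel S₀ x x' y * supportResolvent W ε' S₀ * noiseKernel S₀ x x' y).trace ≤
      32 * (T * (supportResolvent W ε' S₀).trace / (n * Fintype.card V)) + 128 * ℓ * (T / n) ^ 2)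
    (hq : (supportResolvent W ε' S₀).trace ≤ q) :
    l2NormSq ((S₁ : Matrix V V ℝ) - (S₀ : Matrix V V ℝ)) ≤
      264 * (q * Fintype.card V * T / n) + ε' * l2NormSq (sqrtMatrix W * (S₀ : Matrix V V ℝ)) +
        1024 * ℓ * (Fintype.card V * T / n) ^ 2 := by
  have : (0 : ℝ) < n := Nat.cast_pos.2 hn
  have hm : (0 : ℝ) < Fintype.card V := Nat.cast_pos.2 Fintype.card_pos
  have ht' : 0 ≤ t + Real.log (2 * Fintype.card V) :=
    add_nonneg ht (log_two_mul_nonneg Fintype.card_pos)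
  have horacle := l2NormSq_sub_le_of_isMinOn hW (nuclearPenalty_nonneg _ _ _) hε' hD h₀ h₁ hmin
    hnoise
  rw [nuclearPenalty_sq ht'] at horacle
  set m := (Fintype.card V : ℝ)
  set Q := (supportResolvent W ε' S₀).trace
  have hQ0 : 0 ≤ Q := (supportResolvent_nonneg hW hε' S₀).posSemidef.trace_nonneg
  calc
    _ ≤ ε' * l2NormSq (sqrtMatrix W * (S₀ : Matrix V V ℝ)) + m ^ 2 *
        (8 * (32 * (T * Q / (n * m)) + 128 * ℓ * (T / n) ^ 2) + 16 * (T / (n * m)) / 2 * Q) := by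
      refine horacle.trans ?_
      gcongr
    _ = 264 * (Q * m * T / n) + ε' * l2NormSq (sqrtMatrix W * (S₀ : Matrix V V ℝ)) +
        1024 * ℓ * (m * T / n) ^ 2 := by
      field_simp
      ring
    _ ≤ _ := by
      have := ht'.trans hT
      gcongr

variable [MeasurableSpace V] [MeasurableSingletonClass V] {Ω : Type*} [MeasurableSpace Ω]
  {μ : Measure Ω} [IsProbabilityMeasure μ] {n : ℕ} {X X' : Fin n → Ω → V} {Y : Fin n → Ω → ℝ}
  {S : SymKernel V}

theorem IsSimilaritySample.measureReal_lt_norm_off_support_le (h : IsSimilaritySample μ S X X' Y)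
    (hS : (S : Matrix V V ℝ) ≠ 0) (hn : 0 < n) {t : ℝ} (ht : 0 ≤ t)
    (htn : Fintype.card V * (t + Real.log (2 * Fintype.card V)) ≤ n) :
    μ.real {ω | nuclearPenalty t n (Fintype.card V) / 2 < ‖(1 - supportProj S) *
      noiseKernel S (fun j => X j ω) (fun j => X' j ω) (fun j => Y j ω) * (1 - supportProj S)‖} ≤
      9 / 10 * Real.exp (-t) := by
  rcases Nat.lt_or_ge 1 (Fintype.card V) with hcard | hcard
  · have ht' := add_nonneg ht (log_two_mul_nonneg hcard.le)
    have hpenalty : nuclearPenalty t n (Fintype.card V) / 2 =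
        2 * √((t + Real.log (2 * Fintype.card V)) / (n * Fintype.card V)) := by
      rw [nuclearPenalty]
      ring
    rw [hpenalty]
    exact (measureReal_mono fun ω hω => hω.le.trans (norm_off_support_le S _)).trans <|
      (h.measureReal_le_norm_noiseKernel_le hcard hn ht' htn).trans
        (two_mul_mul_exp_neg_le ht hcard)
  · have hnonneg : ¬ nuclearPenalty t n (Fintype.card V) / 2 < 0 :=
      (div_nonneg (nuclearPenalty_nonneg _ _ _) zero_le_two).not_gt
    simp only [supportProj_eq_one_of_card_le_one hS hcard, sub_self, zero_mul, norm_zero, hnonneg,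
      Set.ofPred_false, measureReal_empty]
    positivity

theorem one_sub_add_le_measureReal {A B G : Set Ω} {a b : ℝ} (hA : μ.real A ≤ a)
    (hB : μ.real B ≤ b) (hG : ∀ ω, ω ∉ A → ω ∉ B → ω ∈ G) : 1 - (a + b) ≤ μ.real G := by
  have hcover : Set.univ ⊆ A ∪ B ∪ G := fun ω _ => by
    by_cases hωA : ω ∈ A
    · exact .inl (.inl hωA)
    · by_cases hωB : ω ∈ B
      · exact .inl (.inr hωB)
      · exact .inr (hG ω hωA hωB)
  have hunion : 1 ≤ μ.real A + μ.real B + μ.real G :=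
    calc
      1 = μ.real Set.univ := probReal_univ.symm
      _ ≤ μ.real (A ∪ B ∪ G) := measureReal_mono hcover
      _ ≤ μ.real (A ∪ B) + μ.real G := measureReal_union_le _ _
      _ ≤ μ.real A + μ.real B + μ.real G := by
        gcongr
        exact measureReal_union_le _ _
  linarith

theorem theorem3_general {W : Matrix V V ℝ} {lam : ℕ → ℝ} {φ : ℕ → EuclideanSpace ℝ V}
    (hspec : IsSpectralRepresentation W lam φ) {c : ℝ} (hc : 0 ≤ c) {s : ℕ} (hs : 1 ≤ s)
    (hreg : s ≤ Fintype.card V → 0 < lam s ∧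
      ∑ k ∈ Finset.Icc s (Fintype.card V), 1 / lam k ≤ c * (s / lam s))
    {ε' : ℝ} (hε' : invEigenvalue (Fintype.card V) lam s ≤ ε')
    (hrank : 1 ≤ (S : Matrix V V ℝ).rank) {D : Set (SymKernel V)} (hD : Convex ℝ D) (hSD : S ∈ D)
    (hsample : IsSimilaritySample μ S X X' Y) {t T : ℝ} (ht : 0 ≤ t)
    (hT : t + Real.log (8 * Fintype.card V) ≤ T) (hTn : Fintype.card V * T ≤ n)
    {Shat : Ω → SymKernel V} (hShat : ∀ ω, Shat ω ∈ D ∧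
      IsMinOn (penalizedRisk W (nuclearPenalty t n (Fintype.card V)) ε'
        (fun j => X j ω) (fun j => X' j ω) (fun j => Y j ω)) D (Shat ω)) :
    1 - Real.exp (-t) ≤ μ.real {ω |
      l2NormSq ((Shat ω : Matrix V V ℝ) - (S : Matrix V V ℝ)) ≤
        264 * ((1 + c) * coherence (kernelSupport S) φ s * Fintype.card V * T / n) +
          ε' * l2NormSq (sqrtMatrix W * (S : Matrix V V ℝ)) +
          1024 * maxLeverage (kernelSupport S) * (Fintype.card V * T / n) ^ 2} := by
  have hS : (S : Matrix V V ℝ) ≠ 0 := fun h => by simp [h] at hrank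
  have : Nonempty V := not_isEmpty_iff.1 fun _ => hS (Subsingleton.elim _ _)
  have hcard : 1 ≤ Fintype.card V := Fintype.card_pos
  have hlog : 0 < Real.log (8 * Fintype.card V) := Real.log_pos (by norm_cast; omega)
  have hTpos : 0 < T := by linarith
  have hT' := add_log_two_mul_le hcard hT
  have hn : 0 < n := Nat.cast_pos.1 ((mul_pos (Nat.cast_pos.2 hcard) hTpos).trans_le hTn)
  have hW := hspec.matrix_nonneg
  have hε'_nonneg := (hspec.invEigenvalue_nonneg hs).trans hε'
  have hoff := hsample.measureReal_lt_norm_off_support_le hS hn ht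
    ((mul_le_mul_of_nonneg_left hT' (Nat.cast_nonneg _)).trans hTn)
  have hon := (hsample.measureReal_lt_trace_noiseKernel_mul_mul_le hn
    (supportResolvent_nonneg hW hε'_nonneg S) (maxLeverage_nonneg _)
    (supportResolvent_apply_self_le_maxLeverage hW hε'_nonneg S) hTpos.le).trans
    (two_mul_sq_add_one_mul_exp_neg_le ht hcard hT)
  rw [show 1 - Real.exp (-t) = 1 - (9 / 10 * Real.exp (-t) + 1 / 10 * Real.exp (-t)) by ring]
  refine one_sub_add_le_measureReal hoff hon fun ω hoffω honω => ?_
  exact l2NormSq_sub_le_of_isMinOn_of_trace_le hW hε'_nonneg hn hD hSD (hShat ω).1 ht hT'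
    (hShat ω).2 (not_lt.1 hoffω) (not_lt.1 honω)
    (hspec.trace_supportResolvent_le_coherence hc hs hreg hε' S)

end ErrorBound

theorem theorem3 (c : ℝ) (hc : 0 < c) :
    ∃ C C₁ : ℝ, 0 < C ∧ 0 < C₁ ∧
      ∀ (V : Type*) [Fintype V] [DecidableEq V] [MeasurableSpace V] [MeasurableSingletonClass V]
        (W : Matrix V V ℝ) (lam : ℕ → ℝ) (φ : ℕ → EuclideanSpace ℝ V) (k₀ : ℕ) (ζ : ℝ)
        (Sstar : SymKernel V) (D : Set (SymKernel V)) (n : ℕ) (t : ℝ)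
        (Ω : Type*) [MeasurableSpace Ω] (μ : MeasureTheory.Measure Ω)
        [MeasureTheory.IsProbabilityMeasure μ]
        (X X' : Fin n → Ω → V) (Y : Fin n → Ω → ℝ),
        IsSpectralRepresentation W lam φ →
        1 ≤ ζ →
        SpectrumRegular (Fintype.card V) lam k₀ c ζ →
        1 ≤ (Sstar : Matrix V V ℝ).rank →
        IsClosed D → Convex ℝ D → Sstar ∈ D →
        IsSimilaritySample μ Sstar X X' Y →
        0 < t →
        (Fintype.card V : ℝ) * tnm t ζ n (Fintype.card V) ≤ n →
        ∀ s ∈ Finset.Icc (k₀ + 1) (Fintype.card V + 1),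
        ∀ ε' ∈ Set.Icc (invEigenvalue (Fintype.card V) lam s)
          (invEigenvalue (Fintype.card V) lam (s - 1)),
        ∀ Shat : Ω → SymKernel V,
          (∀ ω, Shat ω ∈ D ∧
            IsMinOn (penalizedRisk W (nuclearPenalty t n (Fintype.card V)) ε'
              (fun j => X j ω) (fun j => X' j ω) (fun j => Y j ω)) D (Shat ω)) →
          1 - Real.exp (-t) ≤ μ.real {ω |
            l2NormSq ((Shat ω : Matrix V V ℝ) - (Sstar : Matrix V V ℝ)) ≤
              C * (coherence (kernelSupport Sstar) φ s * Fintype.card V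
                    * tnm t ζ n (Fintype.card V) / n)
              + ε' * l2NormSq (sqrtMatrix W * (Sstar : Matrix V V ℝ))
              + C₁ * maxLeverage (kernelSupport Sstar)
                  * (Fintype.card V * tnm t ζ n (Fintype.card V) / n) ^ 2} := by
  refine ⟨264 * (1 + c), 1024, by positivity, by norm_num, ?_⟩
  intro V _ _ _ _ W lam φ k₀ ζ S D n t Ω _ μ _ X X' Y hspec hζ hreg hrank _ hD hSD hsample ht hn
    s hs ε' hε' Shat hShat
  obtain ⟨⟨hk₀, hpos⟩, -⟩ := hreg.isLeast
  have hk₀' := Finset.mem_Icc.1 hk₀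
  have hk₀s : k₀ ≤ s := Nat.le_of_succ_le (Finset.mem_Icc.1 hs).1
  have hcard := hk₀'.1.trans hk₀'.2
  have htail (hsm : s ≤ Fintype.card V) := And.intro
    (hpos.trans_le (hspec.mono k₀ hk₀ s (Finset.mem_Icc.2 ⟨hk₀'.1.trans hk₀s, hsm⟩) hk₀s))
    (hreg.tail s hk₀s hsm)
  have htnm := le_tnm t (zero_le_one.trans hζ) hcard (pos_of_mul_tnm_le ht hζ hcard hn)
  have hbound := theorem3_general hspec hc.le (hk₀'.1.trans hk₀s) htail hε'.1 hrank hD hSD hsample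
    ht.le htnm hn hShat
  simpa only [← mul_div_assoc, ← mul_assoc] using hbound
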